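/- Let $k\ge 2$, let $\mathbb F_k$ be the free group on $k$ generators with counting measure, and let $\chi_n$ be the indicator function of the set of reduced words of length $n$. Let $1<p<2$ and $p'=p/(p-1)$. For $f:\mathbb F_k\to\mathbb C$ and $t>0$ put $d_f(t)=\#\{x:|f(x)|>t\}\in[0,\infty]$, and let $$\|f\|_{(p,\infty)}=\sup_{t>0}t\,d_f(t)^{1/p},\qquad \|f\|_{(p,p')}=\Big(p\int_0^\infty t^{p'-1}d_f(t)^{p'/p}\,dt\Big)^{1/p'}$$ be the usual Lorentz quasi-norms, with values in $[0,\infty]$; $L^{(p,\infty)}$ and $L^{(p,p')}$ are the spaces of functions for which they are finite. Let $\lambda(f)g=f*g$, $(f*g)(x)=\sum_{y}f(y)g(y^{-1}x)$. The operator $\lambda(f)$ is of weak type $(p,p)$ if for every $g\in\ell^p(\mathbb F_k)$ the series defining $f*g$ converges absolutely at every point and $f*g\in L^{(p,\infty)}$. Let $\|\lambda(f)\|_{p\to(p,\infty)}\in[0,\infty]$ be the infimum of all $A\in[0,\infty]$ such that for every $g\in\ell^p(\mathbb F_k)$ the series converges absolutely at every point and $\|f*g\|_{(p,\infty)}\le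 A\|g\|_p$ (it is $\infty$ if there is no such $A$). Then there are constants $C,c>0$, depending only on $k$ and $p$, such that: (1) for every radial function $f=\sum_{n=0}^\infty f_n\chi_n$ with complex coefficients, $\|\lambda(f)\|_{p\to(p,\infty)}\le C\|f\|_{(p,p')}$; (2) for every radial $f=\sum_{n=0}^\infty f_n\chi_n$ with all $f_n\ge 0$, $c\,\|f\|_{(p,p')}\le\|\lambda(f)\|_{p\to(p,\infty)}$; (3) for every radial $f=\sum_{n=0}^\infty f_n\chi_n$ with all $f_n\ge0$, $\lambda(f)$ is of weak type $(p,p)$ if and only if $f\in L^{(p,p')}$. -/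

import Mathlib

open scoped ENNReal

noncomputable section

namespace WeakTypeRadial

/-- The distribution function of `f` with respect to counting measure:
the number of points (possibly infinite) at which `|f|` exceeds `t`. -/
def distribution {X : Type*} (f : X → ℂ) (t : ℝ) : ℝ≥0∞ :=
  ((Set.encard {x : X | t < ‖f x‖} : ℕ∞) : ℝ≥0∞)

/-- The weak `L^p` quasi-norm `‖f‖_{(p,∞)} = sup_{t > 0} t · #{|f| > t}^{1/p}`. -/
def weakNorm {X : Type*} (p : ℝ) (f : X → ℂ) : ℝ≥0∞ :=
  ⨆ (t : ℝ) (_ : 0 < t), ENNReal.ofReal t * distribution f t ^ (1 / p)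

/-- The Lorentz quasi-norm `‖f‖_{(p,q)}` for finite `q`,
`(p ∫_0^∞ t^{q-1} #{|f| > t}^{q/p} dt)^{1/q}`. With `f^*` the decreasing rearrangement of `f`,
this is the same number as `(∫_0^∞ (s^{1/p} f^*(s))^q ds/s)^{1/q}`. -/
def lorentzNorm {X : Type*} (p q : ℝ) (f : X → ℂ) : ℝ≥0∞ :=
  (ENNReal.ofReal p *
    ∫⁻ t in Set.Ioi (0 : ℝ), ENNReal.ofReal (t ^ (q - 1)) * distribution f t ^ (q / p)) ^ (1 / q)

/-- The convolution `(f * g)(x) = ∑_y f(y) g(y⁻¹ x)`. -/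
def conv {G : Type*} [Group G] (f g : G → ℂ) (x : G) : ℂ :=
  ∑' y : G, f y * g (y⁻¹ * x)

/-- The series defining `f * g` converges absolutely at every point. -/
def ConvConverges {G : Type*} [Group G] (f g : G → ℂ) : Prop :=
  ∀ x : G, Summable fun y : G => f y * g (y⁻¹ * x)

/-- `λ(f) : g ↦ f * g` is of weak type `(p,p)`: it is defined on all of `ℓ^p(G)` and maps it
into `L^{(p,∞)}`. -/
def IsWeakType {G : Type*} [Group G] (p : ℝ) (f : G → ℂ) : Prop :=
  ∀ g : lp (fun _ : G => ℂ) (ENNReal.ofReal p),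
    ConvConverges f g ∧ weakNorm p (conv f g) < ∞

/-- The norm `‖λ(f)‖_{p → (p,∞)}`, an element of `[0,∞]`: the least `A` with
`‖f * g‖_{(p,∞)} ≤ A ‖g‖_p` for all `g ∈ ℓ^p(G)`. It is `∞` if `λ(f)` is unbounded, or is not
defined on all of `ℓ^p(G)`. -/
def opNorm {G : Type*} [Group G] (p : ℝ) (f : G → ℂ) : ℝ≥0∞ :=
  sInf {A : ℝ≥0∞ | ∀ g : lp (fun _ : G => ℂ) (ENNReal.ofReal p),
    ConvConverges f g ∧ weakNorm p (conv f g) ≤ A * ENNReal.ofReal ‖g‖}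

/-- The radial function `∑_n a_n χ_n` on the free group on `k` generators, where `χ_n` is the
indicator function of the set of reduced words of length `n`. -/
def radial (k : ℕ) (a : ℕ → ℂ) : FreeGroup (Fin k) → ℂ :=
  fun x => a (FreeGroup.norm x)

end WeakTypeRadial

end

/-!
Write `q = 2 * k - 1` and, for a radial function with coefficients `a n`, put
`V = ∑ |a n| ^ p' * q ^ (n * (p' - 1))` (`WeakTypeRadial.radialSum`). Spheres have between `q ^ n`
and `2 * q ^ n` points, so a sum of sphere sizes is governed by its largest term, and the Lorentz
norm of the function is comparable to `V ^ (1 / p')` (`exists_lorentzNorm_equiv`). It remains to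
compare the operator norm with `V ^ (1 / p')`.

Upper bound (`exists_opNorm_le`). Here `f * g` is an integral operator on the tree, whose kernel
depends on the distance `n` of `x` and `z`. Remove the longest common suffix of the words `x` and
`z`: a path of length `n` climbs `i` steps towards the root and descends `j` steps, `i + j = n`.
For given `i` and `j`, each `x` sees at most `2 * q ^ j` points and each `z` is seen from at most
`2 * q ^ i` points. After normalization, choose `H n ≥ |a n| * q ^ n` with
`∑ H n ^ p' * q ^ (-n)` bounded and `H` of at least geometric growth (`exists_growth_majorant`).
To count the points with `f * g > 1`, cut `g`, separately for every `n`, at the height where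
`g ^ (p - 1) = H n`. The part above the cut is estimated in `ℓ^1` (`exists_tsum_high_le`). The part
below the cut is estimated in `ℓ^r`, `p < r < 2`, by one weighted Hölder inequality over all
`i`, `j` and `z` (`exists_tsum_low_le`). By the growth of `H`, all sums over `n` that occur are
dominated by the term at the cut, and both parts are bounded by `∑ g ^ p`.

Lower bound (`radialSum_le_opNorm`). For `|x| = N` only the points on the geodesic from `x` to the
root are used, so that `(f * g)(x) ≥ ∑_{n ≤ N} a n * g (N - n)` for radial `g ≥ 0`. With a unit
vector `g` extremal in Hölder's inequality, this exceeds a multiple of `q ^ (-N / p)` times the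
truncated `V ^ (1 / p')` on the whole sphere of radius `N` (`exists_test_function`). If `V = ∞`,
a geometric series of such test functions lies in `ℓ^p` but is not mapped into weak `L^p`
(`radialSum_ne_top_of_isWeakType`).
-/

open scoped ENNReal

/-! ### Reduced words and the geometry of the tree -/

namespace FreeGroup

/-- The reduced words of length `n` in the letters of `FreeGroup (Fin k)`, built letter by letter
from the right. -/
def reducedWords (k : ℕ) : ℕ → Finset (List (Fin k × Bool))
  | 0 => {[]}
  | n + 1 => ((reducedWords k n ×ˢ Finset.univ).filter fun la =>
      ∀ b ∈ la.1.head?, la.2.1 = b.1 → la.2.2 = b.2).image fun la => la.2 :: la.1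

theorem mem_reducedWords {k n : ℕ} {l : List (Fin k × Bool)} :
    l ∈ reducedWords k n ↔ IsReduced l ∧ l.length = n := by
  induction n generalizing l with
  | zero =>
    simp only [reducedWords, Finset.mem_singleton, List.length_eq_zero_iff]
    exact ⟨fun h => ⟨h ▸ IsReduced.nil, h⟩, fun h => h.2⟩
  | succ n ih =>
    cases l with
    | nil => simp [reducedWords]
    | cons a l =>
      have : IsReduced (a :: l) ↔ (∀ b ∈ l.head?, a.1 = b.1 → a.2 = b.2) ∧ IsReduced l := by
        unfold IsReduced
        rw [List.isChain_cons]
      rw [this]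
      simp only [reducedWords, Finset.mem_image, Finset.mem_filter, Finset.mem_product,
        Finset.mem_univ, and_true, List.length_cons, Nat.add_right_cancel_iff]
      constructor
      · rintro ⟨⟨l', a'⟩, ⟨h1, h2⟩, h3⟩
        simp only [List.cons.injEq] at h3
        obtain ⟨rfl, rfl⟩ := h3
        exact ⟨⟨h2, (ih.1 h1).1⟩, (ih.1 h1).2⟩
      · rintro ⟨⟨h2, h1⟩, h3⟩
        exact ⟨(l, a), ⟨ih.2 ⟨h1, h3⟩, h2⟩, rfl⟩

theorem card_reducedWords_succ (k n : ℕ) :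
    (reducedWords k (n + 1)).card = ∑ l ∈ reducedWords k n,
      (Finset.univ.filter fun a : Fin k × Bool => ∀ b ∈ l.head?, a.1 = b.1 → a.2 = b.2).card := by
  rw [reducedWords, Finset.card_image_of_injective _ (by
    rintro ⟨l, a⟩ ⟨l', a'⟩ h
    simpa [and_comm] using h), Finset.card_filter, Finset.sum_product]
  simp_rw [Finset.card_filter]

/-- All letters but the inverse of the first one may be put in front of a nonempty reduced word. -/
theorem card_letters_ne_inv {k : ℕ} (b : Fin k × Bool) :
    (Finset.univ.filter fun a : Fin k × Bool => a.1 = b.1 → a.2 = b.2).card = 2 * k - 1 := by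
  have : (Finset.univ.filter fun a : Fin k × Bool => a.1 = b.1 → a.2 = b.2) =
      Finset.univ.erase (b.1, !b.2) := by
    ext ⟨a1, a2⟩
    simp only [Finset.mem_filter, Finset.mem_univ, true_and, Finset.mem_erase, ne_eq,
      Prod.mk.injEq, not_and, and_true, Bool.eq_not]
    cases a2 <;> cases b.2 <;> simp
  rw [this, Finset.card_erase_of_mem (Finset.mem_univ _)]
  simp [mul_comm]

theorem card_reducedWords_one (k : ℕ) : (reducedWords k 1).card = 2 * k := by
  rw [card_reducedWords_succ]
  simp [reducedWords, mul_comm]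

theorem card_reducedWords_add_two (k n : ℕ) :
    (reducedWords k (n + 2)).card = (2 * k - 1) * (reducedWords k (n + 1)).card := by
  rw [card_reducedWords_succ, Finset.sum_const_nat (m := 2 * k - 1), mul_comm]
  intro l hl
  obtain ⟨b, l', rfl⟩ := List.exists_cons_of_length_eq_add_one (mem_reducedWords.1 hl).2
  rw [← card_letters_ne_inv b]
  simp

theorem card_reducedWords_le {k : ℕ} (hk : 2 ≤ k) (n : ℕ) :
    (reducedWords k n).card ≤ 2 * (2 * k - 1) ^ n := by
  match n with
  | 0 => simp [reducedWords]
  | n + 1 =>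
    induction n with
    | zero => rw [card_reducedWords_one]; simp; omega
    | succ n ih =>
      rw [card_reducedWords_add_two, pow_succ (2 * k - 1) (n + 1)]
      nlinarith

theorem le_card_reducedWords (k n : ℕ) : (2 * k - 1) ^ n ≤ (reducedWords k n).card := by
  match n with
  | 0 => simp [reducedWords]
  | n + 1 =>
    induction n with
    | zero => rw [card_reducedWords_one]; simp
    | succ n ih =>
      rw [card_reducedWords_add_two, pow_succ (2 * k - 1) (n + 1), mul_comm]
      exact Nat.mul_le_mul_left _ ih

theorem norm_mk_of_isReduced {k : ℕ} {l : List (Fin k × Bool)} (h : IsReduced l) :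
    norm (mk l) = l.length := by
  rw [norm, toWord_mk, h.reduce_eq]

theorem encard_sphere (k n : ℕ) :
    {x : FreeGroup (Fin k) | norm x = n}.encard = (reducedWords k n).card := by
  have : toWord '' {x : FreeGroup (Fin k) | norm x = n} = reducedWords k n := by
    ext l
    simp only [Set.mem_image, Set.mem_ofPred_eq, Finset.mem_coe, mem_reducedWords]
    constructor
    · rintro ⟨x, hx, rfl⟩
      exact ⟨isReduced_toWord, hx⟩
    · rintro ⟨h1, h2⟩
      exact ⟨mk l, by rw [norm_mk_of_isReduced h1, h2], by rw [toWord_mk, h1.reduce_eq]⟩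
  rw [← toWord_injective.encard_image, this, Set.encard_coe_eq_coe_finsetCard]

/-- Remove the longest common suffix of two reduced words: what remains of the first is then
followed by the inverse of what remains of the second without cancellation. -/
theorem IsReduced.exists_common_suffix {k : ℕ} (L M : List (Fin k × Bool)) (hL : IsReduced L)
    (hM : IsReduced M) : ∃ A B C, L = A ++ C ∧ M = B ++ C ∧ IsReduced (A ++ invRev B) := by
  have inv_red : ∀ N : List (Fin k × Bool), IsReduced N → IsReduced (invRev N) := fun N hN => by
    rw [isReduced_iff_reduce_eq, reduce_invRev, hN.reduce_eq]
  induction L using List.reverseRecOn generalizing M with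
  | nil => exact ⟨[], M, [], rfl, by simp, by simpa using inv_red M hM⟩
  | append_singleton L s ih =>
    rcases List.eq_nil_or_concat M with rfl | ⟨M, r, rfl⟩
    · exact ⟨L ++ [s], [], [], by simp, by simp, by simpa [invRev] using hL⟩
    · rw [List.concat_eq_append] at hM ⊢
      by_cases hsr : s = r
      · subst hsr
        obtain ⟨A, B, C, rfl, rfl, h⟩ := ih M (hL.infix (List.prefix_append _ _).isInfix)
          (hM.infix (List.prefix_append _ _).isInfix)
        exact ⟨A, B, C ++ [s], by simp, by simp, h⟩
      · refine ⟨L ++ [s], M ++ [r], [], by simp, by simp, ?_⟩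
        have h2 := inv_red _ hM
        unfold IsReduced at hL h2 ⊢
        rw [List.isChain_append]
        refine ⟨hL, h2, ?_⟩
        simp only [List.getLast?_append, List.getLast?_singleton, Option.some_or, invRev,
          List.map_append, List.map_cons, List.map_nil, List.reverse_append, List.reverse_cons,
          List.reverse_nil, List.nil_append, List.cons_append, List.head?_cons, Option.mem_def,
          Option.some.injEq]
        rintro x rfl y rfl h1
        obtain ⟨s1, s2⟩ := s
        obtain ⟨r1, r2⟩ := r
        simp only [Prod.mk.injEq] at hsr h1 ⊢
        subst h1
        cases s2 <;> cases r2 <;> simp_all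

/-- `IsFork i j x z` says that, in the tree of reduced words in which the neighbours of a word
differ from it by one letter on the left, `x` and `z` lie `i` and `j` steps beyond a common
point of the geodesics which join them to the empty word. -/
def IsFork {k : ℕ} (i j : ℕ) (x z : FreeGroup (Fin k)) : Prop :=
  ∃ A B C, x.toWord = A ++ C ∧ z.toWord = B ++ C ∧ A.length = i ∧ B.length = j

theorem IsFork.symm {k i j : ℕ} {x z : FreeGroup (Fin k)} (h : IsFork i j x z) :
    IsFork j i z x := by
  obtain ⟨A, B, C, h1, h2, h3, h4⟩ := h
  exact ⟨B, A, C, h2, h1, h4, h3⟩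

theorem exists_isFork {k : ℕ} (x z : FreeGroup (Fin k)) :
    ∃ i j, i + j = norm (x * z⁻¹) ∧ IsFork i j x z := by
  obtain ⟨A, B, C, h1, h2, h⟩ := IsReduced.exists_common_suffix x.toWord z.toWord
    isReduced_toWord isReduced_toWord
  refine ⟨A.length, B.length, ?_, A, B, C, h1, h2, rfl, rfl⟩
  have : x * z⁻¹ = mk (A ++ invRev B) := by
    rw [← mk_toWord (x := x), ← mk_toWord (x := z), h1, h2, ← mul_mk, ← mul_mk, ← mul_mk,
      ← inv_mk]
    group
  rw [this, norm_mk_of_isReduced h, List.length_append, invRev_length]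

theorem encard_isFork_le {k : ℕ} (hk : 2 ≤ k) (i j : ℕ) (x : FreeGroup (Fin k)) :
    ({z | IsFork i j x z}.encard : ℝ≥0∞) ≤ 2 * ENNReal.ofReal ((2 * k - 1 : ℝ) ^ j) := by
  have h1 : {z | IsFork i j x z}.encard ≤ (reducedWords k j).card := by
    rw [← Set.encard_coe_eq_coe_finsetCard]
    refine Set.encard_le_encard_of_injOn (f := fun z => z.toWord.take j) ?_ ?_
    · rintro z ⟨A, B, C, h1, h2, h3, rfl⟩
      simp only [Finset.mem_coe, mem_reducedWords]
      rw [h2, List.take_left' rfl]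
      exact ⟨(isReduced_toWord (x := z)).infix (h2 ▸ (List.prefix_append _ _).isInfix), rfl⟩
    · rintro z ⟨A, B, C, h1, h2, h3, rfl⟩ z' ⟨A', B', C', h1', h2', h3', h4'⟩ h
      simp only [h2, h2', List.take_left' rfl, List.take_left' h4'] at h
      apply toWord_injective
      rw [h2, h2', h, (List.append_inj (h1.symm.trans h1') (h3.trans h3'.symm)).2]
  calc ({z | IsFork i j x z}.encard : ℝ≥0∞) ≤ (((reducedWords k j).card : ℕ∞) : ℝ≥0∞) := by
        exact_mod_cast h1
    _ ≤ ((2 * (2 * k - 1) ^ j : ℕ) : ℝ≥0∞) := by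
        rw [ENat.toENNReal_coe]
        exact_mod_cast card_reducedWords_le hk j
    _ = _ := by
        rw [ENNReal.ofReal_pow (by have : (2 : ℝ) ≤ k := by exact_mod_cast hk
                                   linarith)]
        have : ENNReal.ofReal (2 * k - 1 : ℝ) = ((2 * k - 1 : ℕ) : ℝ≥0∞) := by
          rw [← ENNReal.ofReal_natCast]
          push_cast [Nat.cast_sub (show 1 ≤ 2 * k by omega)]
          rfl
        rw [this]
        push_cast
        rfl

end FreeGroup

/-! ### Sums over a discrete set -/

namespace WeakTypeRadial

theorem tsum_mul_le_Lp_mul_Lq {ι : Type*} {r r' : ℝ} (h : r.HolderConjugate r')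
    (f g : ι → ℝ≥0∞) :
    ∑' i, f i * g i ≤ (∑' i, f i ^ r) ^ (1 / r) * (∑' i, g i ^ r') ^ (1 / r') := by
  let _ : MeasurableSpace ι := ⊤
  have := ENNReal.lintegral_mul_le_Lp_mul_Lq (μ := MeasureTheory.Measure.count) h
    (f := f) (g := g) measurable_from_top.aemeasurable measurable_from_top.aemeasurable
  simpa [MeasureTheory.lintegral_count] using this

/-- Chebyshev's inequality for counting measure. -/
theorem encard_le_tsum {X : Type*} (h : X → ℝ≥0∞) {c : ℝ≥0∞} (hc : c ≠ 0) (hc' : c ≠ ∞) :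
    ({x | c ≤ h x}.encard : ℝ≥0∞) ≤ c⁻¹ * ∑' x, h x := by
  rw [← ENNReal.div_eq_inv_mul, ENNReal.le_div_iff_mul_le (Or.inl hc) (Or.inl hc'),
    ← ENNReal.tsum_set_const]
  calc ∑' _ : {x | c ≤ h x}, c ≤ ∑' x : {x | c ≤ h x}, h x := ENNReal.tsum_le_tsum fun x => x.2
    _ ≤ _ := ENNReal.tsum_comp_le_tsum_of_injective Subtype.val_injective _

theorem tsum_ite_const {X : Type*} (s : Set X) [DecidablePred (· ∈ s)] (c : ℝ≥0∞) :
    ∑' x, (if x ∈ s then c else 0) = s.encard * c := by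
  rw [← ENNReal.tsum_set_const, tsum_subtype s fun _ => c]
  simp [Set.indicator]

theorem tsum_add_mul_le (A B : ℕ → ℝ≥0∞) :
    ∑' ij : ℕ × ℕ, A (ij.1 + ij.2) * B ij.2 ≤ (∑' n, A n) * ∑' j, B j := by
  rw [ENNReal.tsum_prod', ENNReal.tsum_comm, ← ENNReal.tsum_mul_left]
  refine ENNReal.tsum_le_tsum fun j => ?_
  simp only [ENNReal.tsum_mul_right]
  exact mul_le_mul_left (ENNReal.tsum_comp_le_tsum_of_injective (add_left_injective j) A) _

theorem tsum_ofReal_pow_lt_top {x : ℝ} (hx0 : 0 ≤ x) (hx : x < 1) :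
    ∑' j : ℕ, ENNReal.ofReal (x ^ j) < ∞ := by
  rw [← ENNReal.ofReal_tsum_of_nonneg (fun j => pow_nonneg hx0 j)
    (summable_geometric_of_lt_one hx0 hx)]
  exact ENNReal.ofReal_lt_top

/-! ### Truncated sums of sequences of geometric growth -/

/-- If `H` grows at least geometrically, the sum of its terms below `M` is at most a multiple
of `M`. -/
theorem tsum_lt_le_of_growth {μ : ℝ} (hμ : 1 < μ) {H : ℕ → ℝ} (h0 : ∀ n, 0 ≤ H n)
    (hH : ∀ n, μ * H n ≤ H (n + 1)) (M : ℝ) :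
    ∑' n, (if H n < M then ENNReal.ofReal (H n) else 0) ≤
      ENNReal.ofReal (μ / (μ - 1)) * ENNReal.ofReal M := by
  have hμ1 : 0 < μ - 1 := by linarith
  -- The sum of all earlier terms is at most a multiple of the next one.
  have full : ∀ N, ∑ n ∈ Finset.range N, H n ≤ H N / (μ - 1) := fun N => by
    induction N with
    | zero => simpa using div_nonneg (h0 0) hμ1.le
    | succ N ih =>
      rw [Finset.sum_range_succ]
      calc _ ≤ H N / (μ - 1) + H N := by linarith
        _ = μ * H N / (μ - 1) := by field_simp; ring
        _ ≤ _ := by gcongr; exact hH N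
  refine ENNReal.tsum_le_of_sum_range_le fun N => ?_
  induction N with
  | zero => simp
  | succ N ih =>
    by_cases hN : H N < M
    · calc _ ≤ ∑ n ∈ Finset.range (N + 1), ENNReal.ofReal (H n) :=
            Finset.sum_le_sum fun n _ => by split_ifs <;> simp
        _ = ENNReal.ofReal (∑ n ∈ Finset.range (N + 1), H n) :=
            (ENNReal.ofReal_sum_of_nonneg fun n _ => h0 n).symm
        _ ≤ ENNReal.ofReal (μ / (μ - 1) * M) := by
            refine ENNReal.ofReal_le_ofReal ?_
            rw [Finset.sum_range_succ]
            calc _ ≤ H N / (μ - 1) + H N := by linarith [full N]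
              _ = μ / (μ - 1) * H N := by field_simp; ring
              _ ≤ _ := by gcongr
        _ = _ := ENNReal.ofReal_mul (by positivity)
    · rw [Finset.sum_range_succ, if_neg hN, add_zero]
      exact ih

/-- If `h` decays at least geometrically, the sum of its terms up to height `M` is at most a
multiple of `M`. -/
theorem tsum_le_le_of_decay {ν : ℝ} (hν : ν < 1) {h : ℕ → ℝ} (h0 : ∀ n, 0 ≤ h n)
    (hh : ∀ n, h (n + 1) ≤ ν * h n) (M : ℝ) :
    ∑' n, (if h n ≤ M then ENNReal.ofReal (h n) else 0) ≤
      ENNReal.ofReal (1 / (1 - ν)) * ENNReal.ofReal M := by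
  have hν1 : 0 < 1 - ν := by linarith
  refine ENNReal.tsum_le_of_sum_range_le fun N => ?_
  induction N generalizing h with
  | zero => simp
  | succ N ih =>
    by_cases hN : h 0 ≤ M
    · have full : ∀ N, ∑ n ∈ Finset.range N, h n ≤ (h 0 - h N) / (1 - ν) := fun N => by
        induction N with
        | zero => simp
        | succ N ih' =>
          rw [Finset.sum_range_succ]
          calc _ ≤ (h 0 - h N) / (1 - ν) + h N := by linarith
            _ = (h 0 - ν * h N) / (1 - ν) := by field_simp; ring
            _ ≤ _ := by gcongr; exact hh N
      calc _ ≤ ∑ n ∈ Finset.range (N + 1), ENNReal.ofReal (h n) :=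
            Finset.sum_le_sum fun n _ => by split_ifs <;> simp
        _ = ENNReal.ofReal (∑ n ∈ Finset.range (N + 1), h n) :=
            (ENNReal.ofReal_sum_of_nonneg fun n _ => h0 n).symm
        _ ≤ ENNReal.ofReal (1 / (1 - ν) * M) := by
            refine ENNReal.ofReal_le_ofReal ((full _).trans ?_)
            rw [div_mul_eq_mul_div, one_mul]
            gcongr
            linarith [h0 (N + 1)]
        _ = _ := ENNReal.ofReal_mul (by positivity)
    · rw [Finset.sum_range_succ', if_neg hN, add_zero]
      exact ih (h := fun n => h (n + 1)) (fun n => h0 _) fun n => hh _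

end WeakTypeRadial

/-! ### The weak type estimate -/

namespace WeakTypeRadial

/-- The majorant is given by `H n ^ p' = P n`, where `P (n + 1) = 2 * P n + a (n + 1)` and
`a n = (w n * q ^ n) ^ p'`. As `2 < q`, the sum of `P n * q ^ (-n)` stays bounded. The extra `1`
in `P 0` keeps `H` positive. -/
theorem exists_growth_majorant {q : ℝ} (hq : 3 ≤ q) {p' : ℝ} (hp' : 0 < p') (w : ℕ → ℝ)
    (hw : ∀ n, 0 ≤ w n) (hsum : ∑' n, ENNReal.ofReal (w n ^ p' * (q ^ n) ^ (p' - 1)) ≤ 1) :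
    ∃ H : ℕ → ℝ, (∀ n, 0 < H n) ∧ (∀ n, (2 : ℝ) ^ (1 / p') * H n ≤ H (n + 1)) ∧
      (∀ n, w n ≤ H n * (q ^ n)⁻¹) ∧ ∑' n, ENNReal.ofReal (H n ^ p' * (q ^ n)⁻¹) ≤ 6 := by
  have hq0 : 0 < q := by linarith
  set a : ℕ → ℝ := fun n => (w n * q ^ n) ^ p' with ha
  have ha0 : ∀ n, 0 ≤ a n := fun n => Real.rpow_nonneg (mul_nonneg (hw n) (by positivity)) _
  have haq : ∀ n, a n * (q ^ n)⁻¹ = w n ^ p' * (q ^ n) ^ (p' - 1) := fun n => by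
    have : 0 < q ^ n := by positivity
    rw [ha]
    simp only
    rw [Real.mul_rpow (hw n) this.le, Real.rpow_sub_one this.ne']
    field_simp
  let P : ℕ → ℝ := fun n => Nat.rec (1 + a 0) (fun m y => 2 * y + a (m + 1)) n
  have hP0 : P 0 = 1 + a 0 := rfl
  have hPs : ∀ n, P (n + 1) = 2 * P n + a (n + 1) := fun n => rfl
  have hPpos : ∀ n, 0 < P n := fun n => by
    induction n with
    | zero => rw [hP0]; linarith [ha0 0]
    | succ n ih => rw [hPs]; linarith [ha0 (n + 1)]
  have haP : ∀ n, a n ≤ P n := fun n => by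
    cases n with
    | zero => rw [hP0]; linarith
    | succ n => rw [hPs]; linarith [hPpos n]
  have hA : ∀ N, ∑ n ∈ Finset.range N, a n * (q ^ n)⁻¹ ≤ 1 := fun N => by
    have h1 := (ENNReal.sum_le_tsum (Finset.range N)).trans hsum
    rw [← ENNReal.ofReal_sum_of_nonneg (fun n _ => mul_nonneg (Real.rpow_nonneg (hw n) _)
      (by positivity)), ENNReal.ofReal_le_one] at h1
    simpa only [haq] using h1
  have hS : ∀ N, ∑ n ∈ Finset.range N, P n * (q ^ n)⁻¹ ≤ 6 := fun N => by
    have step : ∀ N, ∑ n ∈ Finset.range (N + 1), P n * (q ^ n)⁻¹ ≤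
        1 + ∑ n ∈ Finset.range (N + 1), a n * (q ^ n)⁻¹ +
          2 / 3 * ∑ n ∈ Finset.range N, P n * (q ^ n)⁻¹ := fun N => by
      rw [Finset.sum_range_succ', Finset.sum_range_succ' (fun n => a n * (q ^ n)⁻¹), hP0,
        Finset.mul_sum]
      have : ∀ n, P (n + 1) * (q ^ (n + 1))⁻¹ ≤
          a (n + 1) * (q ^ (n + 1))⁻¹ + 2 / 3 * (P n * (q ^ n)⁻¹) := fun n => by
        rw [hPs, add_mul, add_comm]
        refine add_le_add le_rfl ?_
        have h3 : q⁻¹ ≤ 1 / 3 := by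
          rw [inv_le_comm₀ hq0 (by norm_num)]
          linarith
        have h4 : 0 ≤ P n * (q ^ n)⁻¹ := mul_nonneg (hPpos n).le (by positivity)
        rw [pow_succ, mul_inv]
        nlinarith
      have := Finset.sum_le_sum fun n (_ : n ∈ Finset.range N) => this n
      rw [Finset.sum_add_distrib] at this
      simp only [pow_zero, inv_one, mul_one]
      linarith
    induction N with
    | zero => simp
    | succ N ih => linarith [step N, hA (N + 1)]
  refine ⟨fun n => P n ^ (1 / p'), fun n => Real.rpow_pos_of_pos (hPpos n) _, fun n => ?_,
    fun n => ?_, ?_⟩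
  · rw [← Real.mul_rpow (by norm_num) (hPpos n).le]
    refine Real.rpow_le_rpow (by linarith [hPpos n]) ?_ (by positivity)
    rw [hPs]
    linarith [ha0 (n + 1)]
  · rw [← div_eq_mul_inv, le_div_iff₀ (by positivity)]
    calc w n * q ^ n = a n ^ (1 / p') := by
          rw [ha, one_div, Real.rpow_rpow_inv (mul_nonneg (hw n) (by positivity)) hp'.ne']
      _ ≤ _ := Real.rpow_le_rpow (ha0 n) (haP n) (by positivity)
  · refine ENNReal.tsum_le_of_sum_range_le fun N => ?_
    have h6 : (6 : ℝ≥0∞) = ENNReal.ofReal 6 := by simp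
    rw [← ENNReal.ofReal_sum_of_nonneg (fun n _ => mul_nonneg
      (Real.rpow_nonneg (Real.rpow_nonneg (hPpos n).le _) _) (by positivity)), h6]
    refine ENNReal.ofReal_le_ofReal ((Finset.sum_congr rfl fun n _ => ?_).trans_le (hS N))
    rw [one_div, Real.rpow_inv_rpow (hPpos n).le hp'.ne']

/-- Summing over `x` first replaces the relation `R i j` by the number of `x` related to `z`. -/
theorem tsum_tsum_rel_le {X : Type*} {R : ℕ → ℕ → X → X → Prop} {q : ℝ}
    (hR : ∀ i j z, ({x | R i j x z}.encard : ℝ≥0∞) ≤ 2 * ENNReal.ofReal (q ^ i))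
    (c : (ℕ × ℕ) × X → ℝ≥0∞) [∀ i j x z, Decidable (R i j x z)] :
    ∑' x, ∑' κ : (ℕ × ℕ) × X, (if R κ.1.1 κ.1.2 x κ.2 then c κ else 0) ≤
      ∑' z, ∑' ij : ℕ × ℕ, 2 * ENNReal.ofReal (q ^ ij.1) * c (ij, z) := by
  rw [ENNReal.tsum_comm, ENNReal.tsum_prod', ENNReal.tsum_comm]
  refine ENNReal.tsum_le_tsum fun z => ENNReal.tsum_le_tsum fun ij => ?_
  have := tsum_ite_const {x | R ij.1 ij.2 x z} (c (ij, z))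
  simp only [Set.mem_ofPred_eq] at this
  simp only [this]
  gcongr
  exact hR _ _ _

/-- The `ℓ^1` bound for the part of `u` above the cut `u ^ (p - 1) = H n`. Here `H n * q ^ (-n)`
stands for the coefficient of the kernel at distance `n`. -/
theorem exists_tsum_high_le {q : ℝ} (hq : 1 < q) {μ : ℝ} (hμ : 1 < μ) (p : ℝ) :
    ∃ C : ℝ≥0∞, C ≠ ∞ ∧ ∀ (X : Type) (R : ℕ → ℕ → X → X → Prop)
      [∀ i j x z, Decidable (R i j x z)],
      (∀ i j z, ({x | R i j x z}.encard : ℝ≥0∞) ≤ 2 * ENNReal.ofReal (q ^ i)) →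
      ∀ H : ℕ → ℝ, (∀ n, 0 < H n) → (∀ n, μ * H n ≤ H (n + 1)) →
      ∀ u : X → ℝ, (∀ z, 0 ≤ u z) →
      ∑' x, ∑' κ : (ℕ × ℕ) × X, (if R κ.1.1 κ.1.2 x κ.2 then
        (if H (κ.1.1 + κ.1.2) < u κ.2 ^ (p - 1) then
          ENNReal.ofReal (H (κ.1.1 + κ.1.2) * (q ^ (κ.1.1 + κ.1.2))⁻¹ * u κ.2) else 0) else 0) ≤
      C * ∑' z, ENNReal.ofReal (u z ^ p) := by
  have hq0 : 0 < q := by linarith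
  have hB := tsum_ofReal_pow_lt_top (inv_nonneg.2 hq0.le) (inv_lt_one_of_one_lt₀ hq)
  refine ⟨2 * (ENNReal.ofReal (μ / (μ - 1)) * ∑' j, ENNReal.ofReal (q⁻¹ ^ j)),
    ENNReal.mul_ne_top (by simp) (ENNReal.mul_ne_top (by simp) hB.ne), ?_⟩
  intro X R _ hR H hH0 hH u hu
  refine (tsum_tsum_rel_le hR _).trans ?_
  rw [← ENNReal.tsum_mul_left]
  refine ENNReal.tsum_le_tsum fun z => ?_
  rcases (hu z).eq_or_lt with h0 | hpos
  · simp [← h0]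
  calc ∑' ij : ℕ × ℕ, 2 * ENNReal.ofReal (q ^ ij.1) *
        (if H (ij.1 + ij.2) < u z ^ (p - 1) then
          ENNReal.ofReal (H (ij.1 + ij.2) * (q ^ (ij.1 + ij.2))⁻¹ * u z) else 0)
      = 2 * ENNReal.ofReal (u z) * ∑' ij : ℕ × ℕ,
          (if H (ij.1 + ij.2) < u z ^ (p - 1) then ENNReal.ofReal (H (ij.1 + ij.2)) else 0) *
            ENNReal.ofReal (q⁻¹ ^ ij.2) := by
        rw [← ENNReal.tsum_mul_left]
        refine tsum_congr fun ij => ?_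
        split_ifs
        · rw [mul_assoc (2 : ℝ≥0∞), mul_assoc (2 : ℝ≥0∞), ← ENNReal.ofReal_mul (by positivity),
            ← ENNReal.ofReal_mul (hH0 _).le, ← ENNReal.ofReal_mul (hu z)]
          congr 2
          rw [pow_add, inv_pow]
          field_simp
        · simp
    _ ≤ 2 * ENNReal.ofReal (u z) * ((ENNReal.ofReal (μ / (μ - 1)) *
          ENNReal.ofReal (u z ^ (p - 1))) * ∑' j, ENNReal.ofReal (q⁻¹ ^ j)) := by
        gcongr
        refine (tsum_add_mul_le (fun n => if H n < u z ^ (p - 1) then ENNReal.ofReal (H n) else 0)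
          fun j => ENNReal.ofReal (q⁻¹ ^ j)).trans ?_
        gcongr
        exact tsum_lt_le_of_growth hμ (fun n => (hH0 n).le) hH _
    _ = 2 * (ENNReal.ofReal (μ / (μ - 1)) * ∑' j, ENNReal.ofReal (q⁻¹ ^ j)) *
          (ENNReal.ofReal (u z) * ENNReal.ofReal (u z ^ (p - 1))) := by ring
    _ = _ := by
        rw [← ENNReal.ofReal_mul (hu z), Real.rpow_sub_one hpos.ne']
        congr 2
        field_simp

/-- The weights of the Hölder inequality behind the bound for the low part: the `r`-th power of
the second factor, times the number `q ^ i` of `x` which see a given `z`. -/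
theorem holder_weight_identity {q H : ℝ} (hq : 0 < q) (hH : 0 < H) {r r' p' l : ℝ}
    (hr : r.HolderConjugate r') (i j : ℕ) :
    q ^ i * (H * (q ^ (i + j))⁻¹ *
      (H ^ p' * (q ^ (i + j))⁻¹ * (q ^ (-l)) ^ j) ^ (-(1 / r'))) ^ r =
      H ^ (-(p' * (r - 1) - r)) * (q ^ (-(1 - l * (r - 1)))) ^ j := by
  obtain ⟨h, rfl⟩ : ∃ h, H = Real.exp h := ⟨_, (Real.exp_log hH).symm⟩
  obtain ⟨c, rfl⟩ : ∃ c, q = Real.exp c := ⟨_, (Real.exp_log hq).symm⟩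
  simp only [← Real.exp_mul, ← Real.exp_nat_mul, ← Real.exp_neg, ← Real.exp_add]
  congr 1
  have h1 : r / r' = r - 1 := by
    have := hr.inv_add_inv_eq_one
    have h0 := hr.pos
    have h0' := hr.symm.pos
    field_simp at this ⊢
    linarith
  have h2 : 1 / r' * r = r - 1 := by rw [← h1]; ring
  have e : ∀ Y Z : ℝ, (Y + Z * -(1 / r')) * r = Y * r - Z * (r - 1) := fun Y Z => by
    rw [← h2]; ring
  rw [e]
  push_cast
  ring

/-- The `ℓ^r` bound for the part of `u` below the cut. Hölder's inequality is applied with weights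
`a = H n ^ p' * q ^ (-n - l * j)` for some `l > 1`. Since `l > 1`, the sum of `a` over the points
related to `x` is bounded, and since `l * (r - 1) < 1`, the dual sum converges as well. -/
theorem exists_tsum_low_le {q : ℝ} (hq : 1 < q) {μ : ℝ} (hμ : 1 < μ) {p p' r : ℝ}
    (hp : p.HolderConjugate p') (hpr : p < r) (hr2 : r < 2) :
    ∃ C : ℝ≥0∞, C ≠ ∞ ∧ ∀ (X : Type) (R : ℕ → ℕ → X → X → Prop)
      [∀ i j x z, Decidable (R i j x z)],
      (∀ i j x, ({z | R i j x z}.encard : ℝ≥0∞) ≤ 2 * ENNReal.ofReal (q ^ j)) →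
      (∀ i j z, ({x | R i j x z}.encard : ℝ≥0∞) ≤ 2 * ENNReal.ofReal (q ^ i)) →
      ∀ H : ℕ → ℝ, (∀ n, 0 < H n) → (∀ n, μ * H n ≤ H (n + 1)) →
      ∑' n, ENNReal.ofReal (H n ^ p' * (q ^ n)⁻¹) ≤ 6 →
      ∀ u : X → ℝ, (∀ z, 0 ≤ u z) →
      ∑' x, (∑' κ : (ℕ × ℕ) × X, (if R κ.1.1 κ.1.2 x κ.2 then
        (if H (κ.1.1 + κ.1.2) < u κ.2 ^ (p - 1) then 0 else
          ENNReal.ofReal (H (κ.1.1 + κ.1.2) * (q ^ (κ.1.1 + κ.1.2))⁻¹ * u κ.2)) else 0)) ^ r ≤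
      C * ∑' z, ENNReal.ofReal (u z ^ p) := by
  have hq0 : 0 < q := by linarith
  have hp1 : 1 < p := hp.lt
  have hr1 : 1 < r := hp1.trans hpr
  have hr0 : 0 < r := by linarith
  have hrr := Real.HolderConjugate.conjExponent hr1
  set r' := r.conjExponent with hr'
  have hr'0 : 0 < r' := hrr.symm.pos
  obtain ⟨l, hl1, hl2⟩ : ∃ l, 1 < l ∧ l < 1 / (r - 1) :=
    exists_between (by rw [lt_div_iff₀] <;> linarith)
  have hl3 : 0 < 1 - l * (r - 1) := by
    rw [lt_div_iff₀ (by linarith)] at hl2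
    linarith
  set s := p' * (r - 1) - r with hs
  -- The sum of `H n ^ (-s)` over `H n ≥ u ^ (p - 1)` is at most a multiple of `u ^ (p - r)`.
  have hsp : s * (p - 1) = r - p := by
    have := hp.sub_one_mul_conj
    rw [hs]
    linear_combination (r - 1) * this
  have hs0 : 0 < s := by
    by_contra! h
    nlinarith
  have hB1 := tsum_ofReal_pow_lt_top (x := q ^ (-(l - 1))) (by positivity)
    (Real.rpow_lt_one_of_one_lt_of_neg hq (by linarith))
  have hB2 := tsum_ofReal_pow_lt_top (x := q ^ (-(1 - l * (r - 1)))) (by positivity)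
    (Real.rpow_lt_one_of_one_lt_of_neg hq (by linarith))
  set B1 := ∑' j : ℕ, ENNReal.ofReal ((q ^ (-(l - 1))) ^ j)
  set B2 := ∑' j : ℕ, ENNReal.ofReal ((q ^ (-(1 - l * (r - 1)))) ^ j)
  set ν := μ ^ (-s)
  have hν : ν < 1 := Real.rpow_lt_one_of_one_lt_of_neg hμ (by linarith)
  refine ⟨(2 * (6 * B1)) ^ (1 / r' * r) * (2 * (ENNReal.ofReal (1 / (1 - ν)) * B2)),
    ENNReal.mul_ne_top (ENNReal.rpow_ne_top_of_nonneg (by positivity)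
      (ENNReal.mul_ne_top (by simp) (ENNReal.mul_ne_top (by simp) hB1.ne)))
      (ENNReal.mul_ne_top (by simp) (ENNReal.mul_ne_top (by simp) hB2.ne)), ?_⟩
  intro X R _ hR hR' H hH0 hH hsum u hu
  set a : ℕ × ℕ → ℝ := fun ij =>
    H (ij.1 + ij.2) ^ p' * (q ^ (ij.1 + ij.2))⁻¹ * (q ^ (-l)) ^ ij.2 with ha
  have ha0 : ∀ ij, 0 < a ij := fun ij => by
    have := hH0 (ij.1 + ij.2)
    positivity
  set b : ℕ × ℕ → ℝ := fun ij =>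
    H (ij.1 + ij.2) * (q ^ (ij.1 + ij.2))⁻¹ * a ij ^ (-(1 / r')) with hb
  have hb0 : ∀ ij, 0 < b ij := fun ij => by
    have := hH0 (ij.1 + ij.2)
    have := ha0 ij
    positivity
  set D : (ℕ × ℕ) × X → ℝ≥0∞ := fun κ =>
    if H (κ.1.1 + κ.1.2) < u κ.2 ^ (p - 1) then 0 else ENNReal.ofReal ((b κ.1 * u κ.2) ^ r) with hD
  have first : ∀ x, ∑' κ : (ℕ × ℕ) × X,
      (if R κ.1.1 κ.1.2 x κ.2 then ENNReal.ofReal (a κ.1) else 0) ≤ 2 * (6 * B1) := fun x => by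
    calc _ ≤ ∑' ij : ℕ × ℕ, 2 * (ENNReal.ofReal (H (ij.1 + ij.2) ^ p' * (q ^ (ij.1 + ij.2))⁻¹) *
          ENNReal.ofReal ((q ^ (-(l - 1))) ^ ij.2)) := by
          rw [ENNReal.tsum_prod']
          refine ENNReal.tsum_le_tsum fun ij => ?_
          have := tsum_ite_const {z | R ij.1 ij.2 x z} (ENNReal.ofReal (a ij))
          simp only [Set.mem_ofPred_eq] at this
          rw [this]
          refine (mul_le_mul_left (hR _ _ _) _).trans_eq ?_
          have hHp := hH0 (ij.1 + ij.2)
          rw [mul_assoc, ← ENNReal.ofReal_mul (by positivity),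
            ← ENNReal.ofReal_mul (by positivity)]
          congr 2
          rw [ha]
          simp only
          have : q ^ (-(l - 1)) = q ^ (-l) * q := by
            rw [← Real.rpow_add_one hq0.ne']; congr 1; ring
          rw [this, mul_pow]
          ring
      _ ≤ 2 * (6 * B1) := by
          rw [ENNReal.tsum_mul_left]
          gcongr
          refine (tsum_add_mul_le (fun n => ENNReal.ofReal (H n ^ p' * (q ^ n)⁻¹))
            fun j => ENNReal.ofReal ((q ^ (-(l - 1))) ^ j)).trans ?_
          gcongr
  have holder : ∀ x, (∑' κ : (ℕ × ℕ) × X, (if R κ.1.1 κ.1.2 x κ.2 then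
        (if H (κ.1.1 + κ.1.2) < u κ.2 ^ (p - 1) then 0 else
          ENNReal.ofReal (H (κ.1.1 + κ.1.2) * (q ^ (κ.1.1 + κ.1.2))⁻¹ * u κ.2)) else 0)) ^ r ≤
      (2 * (6 * B1)) ^ (1 / r' * r) *
        ∑' κ : (ℕ × ℕ) × X, (if R κ.1.1 κ.1.2 x κ.2 then D κ else 0) := fun x => by
    have key := tsum_mul_le_Lp_mul_Lq hrr.symm
      (fun κ : (ℕ × ℕ) × X => if R κ.1.1 κ.1.2 x κ.2 then
        ENNReal.ofReal (a κ.1 ^ (1 / r')) else 0)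
      (fun κ : (ℕ × ℕ) × X => if R κ.1.1 κ.1.2 x κ.2 then
        (if H (κ.1.1 + κ.1.2) < u κ.2 ^ (p - 1) then 0 else
          ENNReal.ofReal (b κ.1 * u κ.2)) else 0)
    have e1 : ∀ κ : (ℕ × ℕ) × X, (if R κ.1.1 κ.1.2 x κ.2 then
        ENNReal.ofReal (a κ.1 ^ (1 / r')) else 0) * (if R κ.1.1 κ.1.2 x κ.2 then
        (if H (κ.1.1 + κ.1.2) < u κ.2 ^ (p - 1) then 0 else
          ENNReal.ofReal (b κ.1 * u κ.2)) else 0) = (if R κ.1.1 κ.1.2 x κ.2 then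
        (if H (κ.1.1 + κ.1.2) < u κ.2 ^ (p - 1) then 0 else
          ENNReal.ofReal (H (κ.1.1 + κ.1.2) * (q ^ (κ.1.1 + κ.1.2))⁻¹ * u κ.2)) else 0) :=
      fun κ => by
        have haκ := ha0 κ.1
        split_ifs
        · rw [mul_zero]
        · rw [← ENNReal.ofReal_mul (by positivity)]
          congr 1
          simp only [hb]
          rw [Real.rpow_neg haκ.le]
          field_simp
        · rw [mul_zero]
    have e2 : ∀ κ : (ℕ × ℕ) × X, (if R κ.1.1 κ.1.2 x κ.2 then
        ENNReal.ofReal (a κ.1 ^ (1 / r')) else 0) ^ r' =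
        if R κ.1.1 κ.1.2 x κ.2 then ENNReal.ofReal (a κ.1) else 0 := fun κ => by
      have haκ := ha0 κ.1
      split_ifs
      · rw [ENNReal.ofReal_rpow_of_nonneg (by positivity) hr'0.le, one_div,
          Real.rpow_inv_rpow haκ.le hr'0.ne']
      · exact ENNReal.zero_rpow_of_pos hr'0
    have e3 : ∀ κ : (ℕ × ℕ) × X, (if R κ.1.1 κ.1.2 x κ.2 then
        (if H (κ.1.1 + κ.1.2) < u κ.2 ^ (p - 1) then 0 else
          ENNReal.ofReal (b κ.1 * u κ.2)) else 0) ^ r =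
        if R κ.1.1 κ.1.2 x κ.2 then D κ else 0 := fun κ => by
      simp only [hD]
      split_ifs
      · exact ENNReal.zero_rpow_of_pos hr0
      · exact ENNReal.ofReal_rpow_of_nonneg (mul_nonneg (hb0 _).le (hu _)) hr0.le
      · exact ENNReal.zero_rpow_of_pos hr0
    simp only [e1, e2, e3] at key
    calc _ ≤ _ := ENNReal.rpow_le_rpow key hr0.le
      _ = (∑' κ : (ℕ × ℕ) × X, if R κ.1.1 κ.1.2 x κ.2 then ENNReal.ofReal (a κ.1) else 0)
            ^ (1 / r' * r) * _ := by
          rw [ENNReal.mul_rpow_of_nonneg _ _ hr0.le, ← ENNReal.rpow_mul, ← ENNReal.rpow_mul,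
            one_div_mul_cancel hr0.ne', ENNReal.rpow_one]
      _ ≤ _ := by
          gcongr
          exact first x
  calc _ ≤ _ := ENNReal.tsum_le_tsum holder
    _ ≤ (2 * (6 * B1)) ^ (1 / r' * r) *
          ∑' z, ∑' ij : ℕ × ℕ, 2 * ENNReal.ofReal (q ^ ij.1) * D (ij, z) := by
        rw [ENNReal.tsum_mul_left]
        exact mul_le_mul_right (tsum_tsum_rel_le hR' _) _
    _ ≤ _ := by
        rw [mul_assoc, ← ENNReal.tsum_mul_left (a := 2 * (ENNReal.ofReal (1 / (1 - ν)) * B2))]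
        gcongr with z
        rcases (hu z).eq_or_lt with h0 | hpos
        · simp [hD, ← h0, Real.zero_rpow hr0.ne']
        calc ∑' ij : ℕ × ℕ, 2 * ENNReal.ofReal (q ^ ij.1) * D (ij, z)
            ≤ 2 * ENNReal.ofReal (u z ^ r) * ∑' ij : ℕ × ℕ,
              (if H (ij.1 + ij.2) ^ (-s) ≤ (u z ^ (p - 1)) ^ (-s) then
                ENNReal.ofReal (H (ij.1 + ij.2) ^ (-s)) else 0) *
              ENNReal.ofReal ((q ^ (-(1 - l * (r - 1)))) ^ ij.2) := by
              rw [← ENNReal.tsum_mul_left]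
              refine ENNReal.tsum_le_tsum fun ij => ?_
              rw [hD]
              simp only
              split_ifs with h1 h2 h2
              · simp
              · simp
              · refine le_of_eq ?_
                have hHp := hH0 (ij.1 + ij.2)
                rw [mul_assoc (2 : ℝ≥0∞), mul_assoc (2 : ℝ≥0∞), ← ENNReal.ofReal_mul (by positivity),
                  ← ENNReal.ofReal_mul (by positivity), ← ENNReal.ofReal_mul (by positivity),
                  ← holder_weight_identity hq0 hHp hrr, Real.mul_rpow (hb0 ij).le (hu z)]
                congr 2
                rw [hb, ha]
                ring
              · refine absurd ?_ h2
                exact Real.rpow_le_rpow_of_nonpos (by positivity) (not_lt.1 h1) (by linarith)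
          _ ≤ 2 * ENNReal.ofReal (u z ^ r) * ((ENNReal.ofReal (1 / (1 - ν)) *
                ENNReal.ofReal ((u z ^ (p - 1)) ^ (-s))) * B2) := by
              gcongr
              refine (tsum_add_mul_le (fun n => if H n ^ (-s) ≤ (u z ^ (p - 1)) ^ (-s) then
                ENNReal.ofReal (H n ^ (-s)) else 0)
                fun j => ENNReal.ofReal ((q ^ (-(1 - l * (r - 1)))) ^ j)).trans ?_
              gcongr
              refine tsum_le_le_of_decay (h := fun n => H n ^ (-s)) hν
                (fun n => Real.rpow_nonneg (hH0 n).le _) (fun n => ?_) _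
              have := hH0 n
              rw [← Real.mul_rpow (by linarith) this.le]
              exact Real.rpow_le_rpow_of_nonpos (by positivity) (hH n) (by linarith)
          _ = 2 * (ENNReal.ofReal (1 / (1 - ν)) * B2) *
                (ENNReal.ofReal (u z ^ r) * ENNReal.ofReal ((u z ^ (p - 1)) ^ (-s))) := by ring
          _ = _ := by
              rw [← ENNReal.ofReal_mul (by positivity), ← Real.rpow_mul (hu z),
                ← Real.rpow_add hpos]
              congr 3
              linear_combination -hsp

/-- The weak type estimate with both functions normalized, for any kernel of the form
`w (i + j)` on relations `R i j` with the cardinality bounds of the tree. -/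
theorem exists_encard_le {q : ℝ} (hq : 3 ≤ q) {p p' : ℝ} (hp : p.HolderConjugate p')
    (hp2 : p < 2) :
    ∃ C : ℝ≥0∞, C ≠ ∞ ∧ ∀ (X : Type) (R : ℕ → ℕ → X → X → Prop)
      [∀ i j x z, Decidable (R i j x z)],
      (∀ i j x, ({z | R i j x z}.encard : ℝ≥0∞) ≤ 2 * ENNReal.ofReal (q ^ j)) →
      (∀ i j z, ({x | R i j x z}.encard : ℝ≥0∞) ≤ 2 * ENNReal.ofReal (q ^ i)) →
      ∀ w : ℕ → ℝ, (∀ n, 0 ≤ w n) →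
      ∑' n, ENNReal.ofReal (w n ^ p' * (q ^ n) ^ (p' - 1)) ≤ 1 →
      ∀ u : X → ℝ, (∀ z, 0 ≤ u z) →
      ({x | 1 < ∑' κ : (ℕ × ℕ) × X, (if R κ.1.1 κ.1.2 x κ.2 then
          ENNReal.ofReal (w (κ.1.1 + κ.1.2) * u κ.2) else 0)}.encard : ℝ≥0∞) ≤
        C * ∑' z, ENNReal.ofReal (u z ^ p) := by
  obtain ⟨r, hpr, hr2⟩ := exists_between hp2
  have hr0 : 0 < r := hp.pos.trans hpr
  have hp'0 : 0 < p' := hp.symm.pos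
  have hμ : 1 < (2 : ℝ) ^ (1 / p') := Real.one_lt_rpow (by norm_num) (by positivity)
  obtain ⟨C₁, hC₁, h₁⟩ := exists_tsum_high_le (by linarith : 1 < q) hμ p
  obtain ⟨C₂, hC₂, h₂⟩ := exists_tsum_low_le (by linarith : 1 < q) hμ hp hpr hr2
  have hhalf : (1 / 2 : ℝ≥0∞) ≠ 0 := by simp
  have hhalf' : (1 / 2 : ℝ≥0∞) ≠ ∞ := by simp
  have hhr : (1 / 2 : ℝ≥0∞) ^ r ≠ 0 := by simp
  have hhr' : (1 / 2 : ℝ≥0∞) ^ r ≠ ∞ := ENNReal.rpow_ne_top_of_nonneg hr0.le hhalf'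
  refine ⟨(1 / 2)⁻¹ * C₁ + ((1 / 2) ^ r)⁻¹ * C₂, ENNReal.add_ne_top.2
    ⟨ENNReal.mul_ne_top (ENNReal.inv_ne_top.2 hhalf) hC₁,
      ENNReal.mul_ne_top (ENNReal.inv_ne_top.2 hhr) hC₂⟩, ?_⟩
  intro X R _ hR hR' w hw hsum u hu
  obtain ⟨H, hH0, hH, hwH, hHsum⟩ := exists_growth_majorant hq hp'0 w hw hsum
  specialize h₁ X R hR' H hH0 hH u hu
  specialize h₂ X R hR hR' H hH0 hH hHsum u hu
  set hi : X → ℝ≥0∞ := fun x => ∑' κ : (ℕ × ℕ) × X, (if R κ.1.1 κ.1.2 x κ.2 then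
        (if H (κ.1.1 + κ.1.2) < u κ.2 ^ (p - 1) then
          ENNReal.ofReal (H (κ.1.1 + κ.1.2) * (q ^ (κ.1.1 + κ.1.2))⁻¹ * u κ.2) else 0) else 0)
    with hhi
  set lo : X → ℝ≥0∞ := fun x => ∑' κ : (ℕ × ℕ) × X, (if R κ.1.1 κ.1.2 x κ.2 then
        (if H (κ.1.1 + κ.1.2) < u κ.2 ^ (p - 1) then 0 else
          ENNReal.ofReal (H (κ.1.1 + κ.1.2) * (q ^ (κ.1.1 + κ.1.2))⁻¹ * u κ.2)) else 0) with hlo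
  have hle : ∀ x, ∑' κ : (ℕ × ℕ) × X, (if R κ.1.1 κ.1.2 x κ.2 then
      ENNReal.ofReal (w (κ.1.1 + κ.1.2) * u κ.2) else 0) ≤ hi x + lo x := fun x => by
    rw [hhi, hlo, ← ENNReal.tsum_add]
    refine ENNReal.tsum_le_tsum fun κ => ?_
    have : ENNReal.ofReal (w (κ.1.1 + κ.1.2) * u κ.2) ≤
        ENNReal.ofReal (H (κ.1.1 + κ.1.2) * (q ^ (κ.1.1 + κ.1.2))⁻¹ * u κ.2) :=
      ENNReal.ofReal_le_ofReal (mul_le_mul_of_nonneg_right (hwH _) (hu _))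
    split_ifs <;> simp [this]
  have hsub : {x | 1 < ∑' κ : (ℕ × ℕ) × X, (if R κ.1.1 κ.1.2 x κ.2 then
      ENNReal.ofReal (w (κ.1.1 + κ.1.2) * u κ.2) else 0)} ⊆
      {x | 1 / 2 ≤ hi x} ∪ {x | (1 / 2) ^ r ≤ lo x ^ r} := fun x hx => by
    by_contra hcon
    simp only [Set.mem_union, Set.mem_ofPred_eq, not_or, not_le] at hcon hx
    have h2 : lo x < 1 / 2 := (ENNReal.rpow_lt_rpow_iff hr0).1 hcon.2
    have := ENNReal.add_lt_add hcon.1 h2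
    rw [ENNReal.add_halves] at this
    exact absurd (hx.trans_le (hle x)) this.not_gt
  calc _ ≤ (({x | 1 / 2 ≤ hi x} ∪ {x | (1 / 2) ^ r ≤ lo x ^ r}).encard : ℝ≥0∞) := by
        exact_mod_cast Set.encard_le_encard hsub
    _ ≤ ({x | 1 / 2 ≤ hi x}.encard : ℝ≥0∞) + ({x | (1 / 2) ^ r ≤ lo x ^ r}.encard : ℝ≥0∞) := by
        exact_mod_cast Set.encard_union_le _ _
    _ ≤ (1 / 2)⁻¹ * (C₁ * ∑' z, ENNReal.ofReal (u z ^ p)) +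
          ((1 / 2) ^ r)⁻¹ * (C₂ * ∑' z, ENNReal.ofReal (u z ^ p)) := by
        refine add_le_add ((encard_le_tsum hi hhalf hhalf').trans ?_)
          ((encard_le_tsum (fun x => lo x ^ r) hhr hhr').trans ?_)
        · exact mul_le_mul_right h₁ _
        · exact mul_le_mul_right h₂ _
    _ = _ := by ring

/-- The power sum `∑ |a n| ^ p' * q ^ (n * (p' - 1))`, `q = 2 * k - 1`, which for radial functions
takes the place of the `p'`-th power of the Lorentz norm. -/
noncomputable def radialSum (k : ℕ) (p' : ℝ) (a : ℕ → ℂ) : ℝ≥0∞ :=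
  ∑' n, ENNReal.ofReal (‖a n‖ ^ p' * ((2 * k - 1 : ℝ) ^ n) ^ (p' - 1))

theorem three_le_two_mul_sub_one {k : ℕ} (hk : 2 ≤ k) : (3 : ℝ) ≤ 2 * k - 1 := by
  have : (2 : ℝ) ≤ k := by exact_mod_cast hk
  linarith

open Classical in
theorem tsum_norm_conv_le {k : ℕ} (a : ℕ → ℂ) (g : FreeGroup (Fin k) → ℂ)
    (x : FreeGroup (Fin k)) :
    ∑' y, ENNReal.ofReal ‖radial k a y * g (y⁻¹ * x)‖ ≤
      ∑' κ : (ℕ × ℕ) × FreeGroup (Fin k), (if FreeGroup.IsFork κ.1.1 κ.1.2 x κ.2 then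
        ENNReal.ofReal (‖a (κ.1.1 + κ.1.2)‖ * ‖g κ.2‖) else 0) := by
  rw [ENNReal.tsum_prod', ENNReal.tsum_comm,
    ← ((Equiv.inv (FreeGroup (Fin k))).trans (Equiv.mulLeft x)).tsum_eq]
  refine ENNReal.tsum_le_tsum fun z => ?_
  obtain ⟨i, j, hij, h⟩ := FreeGroup.exists_isFork x z
  refine le_trans (le_of_eq ?_) (ENNReal.le_tsum (i, j))
  simp only [h, if_true]
  simp only [Equiv.trans_apply, Equiv.inv_apply, Equiv.coe_mulLeft, radial, hij, norm_mul,
    mul_inv_rev, inv_inv, inv_mul_cancel_right]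

theorem exists_encard_conv_le {k : ℕ} (hk : 2 ≤ k) {p p' : ℝ} (hp : p.HolderConjugate p')
    (hp2 : p < 2) :
    ∃ C : ℝ, 0 ≤ C ∧ ∀ (a : ℕ → ℂ) (s : ℝ), 0 < s → radialSum k p' a ≤ ENNReal.ofReal (s ^ p') →
      ∀ (g : lp (fun _ : FreeGroup (Fin k) => ℂ) (ENNReal.ofReal p)) (t : ℝ), 0 < t →
      ({x | ENNReal.ofReal t < ∑' y, ENNReal.ofReal ‖radial k a y * g (y⁻¹ * x)‖}.encard : ℝ≥0∞)
        ≤ ENNReal.ofReal (C * (s / t * ‖g‖) ^ p) := by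
  classical
  obtain ⟨C, hC, h⟩ := exists_encard_le (three_le_two_mul_sub_one hk) hp hp2
  refine ⟨C.toReal, ENNReal.toReal_nonneg, fun a s hs hV g t ht => ?_⟩
  have hq : (0 : ℝ) < 2 * k - 1 := by linarith [three_le_two_mul_sub_one hk]
  have hgn : 0 ≤ ‖g‖ := lp.norm_nonneg' g
  have hg : ∑' z, ENNReal.ofReal ((‖g z‖ * (s / t)) ^ p) =
      ENNReal.ofReal ((s / t * ‖g‖) ^ p) := by
    have hpt : (ENNReal.ofReal p).toReal = p := ENNReal.toReal_ofReal hp.nonneg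
    have h1 := lp.hasSum_norm (p := ENNReal.ofReal p) (by rw [hpt]; exact hp.pos) g
    rw [hpt] at h1
    have h2 := h1.mul_right ((s / t) ^ p)
    simp only [← Real.mul_rpow (norm_nonneg _) (div_pos hs ht).le] at h2
    rw [← ENNReal.ofReal_tsum_of_nonneg (fun z => by positivity) h2.summable, h2.tsum_eq,
      mul_comm, ← Real.mul_rpow (div_pos hs ht).le hgn]
  have key := h (FreeGroup (Fin k)) FreeGroup.IsFork (FreeGroup.encard_isFork_le hk)
    (fun i j z => by
      have : {x | FreeGroup.IsFork i j x z} = {x | FreeGroup.IsFork j i z x} :=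
        Set.ext fun x => ⟨fun h => h.symm, fun h => h.symm⟩
      rw [this]
      exact FreeGroup.encard_isFork_le hk j i z)
    (fun n => ‖a n‖ / s) (fun n => by positivity) ?_ (fun z => ‖g z‖ * (s / t))
    (fun z => by positivity)
  · rw [hg] at key
    rw [ENNReal.ofReal_mul ENNReal.toReal_nonneg, ENNReal.ofReal_toReal hC]
    refine le_trans ?_ key
    have : {x | ENNReal.ofReal t < ∑' y, ENNReal.ofReal ‖radial k a y * g (y⁻¹ * x)‖} ⊆
        {x | 1 < ∑' κ : (ℕ × ℕ) × FreeGroup (Fin k),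
          (if FreeGroup.IsFork κ.1.1 κ.1.2 x κ.2 then
            ENNReal.ofReal (‖a (κ.1.1 + κ.1.2)‖ / s * (‖g κ.2‖ * (s / t))) else 0)} := fun x hx => by
      simp only [Set.mem_ofPred_eq] at hx ⊢
      replace hx := hx.trans_le (tsum_norm_conv_le a g x)
      have e : ∀ κ : (ℕ × ℕ) × FreeGroup (Fin k),
          (if FreeGroup.IsFork κ.1.1 κ.1.2 x κ.2 then
            ENNReal.ofReal (‖a (κ.1.1 + κ.1.2)‖ * ‖g κ.2‖) else 0) =
          ENNReal.ofReal t * (if FreeGroup.IsFork κ.1.1 κ.1.2 x κ.2 then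
            ENNReal.ofReal (‖a (κ.1.1 + κ.1.2)‖ / s * (‖g κ.2‖ * (s / t))) else 0) := fun κ => by
        split_ifs
        · rw [← ENNReal.ofReal_mul ht.le]
          congr 1
          field_simp
        · simp
      simp only [e] at hx
      rw [ENNReal.tsum_mul_left] at hx
      by_contra hcon
      have := mul_le_mul_right (not_lt.1 hcon) (ENNReal.ofReal t)
      rw [mul_one] at this
      exact absurd hx this.not_gt
    exact_mod_cast Set.encard_le_encard this
  · have hsp : (0 : ℝ) < s ^ p' := by positivity
    have e : ∀ n, ENNReal.ofReal ((‖a n‖ / s) ^ p' * ((2 * k - 1 : ℝ) ^ n) ^ (p' - 1)) =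
        ENNReal.ofReal (s ^ p')⁻¹ *
          ENNReal.ofReal (‖a n‖ ^ p' * ((2 * k - 1 : ℝ) ^ n) ^ (p' - 1)) := fun n => by
      rw [← ENNReal.ofReal_mul (by positivity), Real.div_rpow (norm_nonneg _) hs.le]
      congr 1
      field_simp
    simp only [e]
    rw [ENNReal.tsum_mul_left]
    refine (mul_le_mul_right hV _).trans_eq ?_
    rw [← ENNReal.ofReal_mul (by positivity), inv_mul_cancel₀ hsp.ne', ENNReal.ofReal_one]

theorem exists_opNorm_le {k : ℕ} (hk : 2 ≤ k) {p p' : ℝ} (hp : p.HolderConjugate p')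
    (hp2 : p < 2) :
    ∃ K : ℝ, 0 < K ∧ ∀ a : ℕ → ℂ,
      opNorm p (radial k a) ≤ ENNReal.ofReal K * radialSum k p' a ^ (1 / p') := by
  obtain ⟨C, hC, h⟩ := exists_encard_conv_le hk hp hp2
  have hp0 := hp.pos
  have hp'0 := hp.symm.pos
  set K := (C + 1) ^ (1 / p) with hK
  have hK0 : 0 < K := by positivity
  have hKp : K ^ p = C + 1 := by rw [hK, one_div, Real.rpow_inv_rpow (by positivity) hp0.ne']
  refine ⟨K, hK0, fun a => ?_⟩
  have main : ∀ s : ℝ, 0 < s → radialSum k p' a ≤ ENNReal.ofReal (s ^ p') →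
      opNorm p (radial k a) ≤ ENNReal.ofReal (K * s) := fun s hs hV => by
    refine sInf_le fun g => ?_
    have hgn : 0 ≤ ‖g‖ := lp.norm_nonneg' g
    have hd : ∀ t : ℝ, 0 < t →
        ({x | ENNReal.ofReal t < ∑' y, ENNReal.ofReal ‖radial k a y * g (y⁻¹ * x)‖}.encard : ℝ≥0∞)
          ≤ ENNReal.ofReal ((K * s * ‖g‖ / t) ^ p) := fun t ht => by
      refine (h a s hs hV g t ht).trans (ENNReal.ofReal_le_ofReal ?_)
      have : K * s * ‖g‖ / t = K * (s / t * ‖g‖) := by ring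
      rw [this, Real.mul_rpow hK0.le (by positivity), hKp]
      gcongr
      linarith
    -- Sets of counting measure less than one are empty.
    have hfin : ∀ x, ∑' y, ENNReal.ofReal ‖radial k a y * g (y⁻¹ * x)‖ ≠ ∞ := fun x hx => by
      have ht : 0 < K * s * ‖g‖ + 1 := by positivity
      have h1 := hd _ ht
      have h2 : (1 : ℕ∞) ≤ {x | ENNReal.ofReal (K * s * ‖g‖ + 1) <
          ∑' y, ENNReal.ofReal ‖radial k a y * g (y⁻¹ * x)‖}.encard := by
        rw [Set.one_le_encard_iff_nonempty]
        exact ⟨x, by simp only [Set.mem_ofPred_eq]; rw [hx]; exact ENNReal.ofReal_lt_top⟩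
      have h3 : (1 : ℝ≥0∞) ≤ ENNReal.ofReal ((K * s * ‖g‖ / (K * s * ‖g‖ + 1)) ^ p) :=
        le_trans (by exact_mod_cast h2) h1
      rw [ENNReal.one_le_ofReal] at h3
      have h4 : K * s * ‖g‖ / (K * s * ‖g‖ + 1) < 1 := by
        rw [div_lt_one ht]
        linarith
      exact absurd h3 (Real.rpow_lt_one (by positivity) h4 hp0).not_ge
    have hsum : ∀ x, Summable fun y => ‖radial k a y * g (y⁻¹ * x)‖ := fun x => by
      have := ENNReal.summable_toReal (hfin x)
      simpa only [ENNReal.toReal_ofReal (norm_nonneg _)] using this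
    refine ⟨fun x => (hsum x).of_norm, iSup₂_le fun t ht => ?_⟩
    have hsub : {x | t < ‖conv (radial k a) g x‖} ⊆
        {x | ENNReal.ofReal t < ∑' y, ENNReal.ofReal ‖radial k a y * g (y⁻¹ * x)‖} :=
      fun x hx => by
        simp only [Set.mem_ofPred_eq] at hx ⊢
        have h1 := hx.trans_le (norm_tsum_le_tsum_norm (hsum x))
        rw [← ENNReal.ofReal_tsum_of_nonneg (fun y => norm_nonneg _) (hsum x)]
        exact (ENNReal.ofReal_lt_ofReal_iff (ht.trans h1)).2 h1
    have h5 : distribution (conv (radial k a) g) t ≤ ENNReal.ofReal ((K * s * ‖g‖ / t) ^ p) :=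
      le_trans (by unfold distribution; exact_mod_cast Set.encard_le_encard hsub) (hd t ht)
    calc _ ≤ ENNReal.ofReal t * ENNReal.ofReal ((K * s * ‖g‖ / t) ^ p) ^ (1 / p) := by gcongr
      _ = _ := by
        rw [ENNReal.ofReal_rpow_of_nonneg (by positivity) (by positivity), one_div,
          Real.rpow_rpow_inv (by positivity) hp0.ne', ← ENNReal.ofReal_mul ht.le,
          ← ENNReal.ofReal_mul (by positivity)]
        congr 1
        field_simp
  by_cases hV : radialSum k p' a = ∞
  · rw [hV, ENNReal.top_rpow_of_pos (by positivity), ENNReal.mul_top (by simpa using hK0)]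
    exact le_top
  · set v := (radialSum k p' a ^ (1 / p')).toReal with hv
    have hVt : radialSum k p' a ^ (1 / p') ≠ ∞ :=
      ENNReal.rpow_ne_top_of_nonneg (by positivity) hV
    have hvV : ENNReal.ofReal v = radialSum k p' a ^ (1 / p') := ENNReal.ofReal_toReal hVt
    have hv0 : 0 ≤ v := ENNReal.toReal_nonneg
    refine ENNReal.le_of_forall_pos_le_add fun ε hε _ => ?_
    have hε' : (0 : ℝ) < ε := hε
    have hle := main (v + ε / K) (by positivity) (by
      rw [← ENNReal.ofReal_rpow_of_nonneg (by positivity) hp'0.le,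
        ← ENNReal.rpow_inv_le_iff hp'0, ← one_div, ← hvV]
      exact ENNReal.ofReal_le_ofReal (by linarith [div_pos hε' hK0]))
    refine hle.trans_eq ?_
    rw [mul_add, mul_div_cancel₀ _ hK0.ne', ENNReal.ofReal_add (by positivity) hε'.le,
      ENNReal.ofReal_mul hK0.le, hvV, ENNReal.ofReal_coe_nnreal]

end WeakTypeRadial

/-! ### The Lorentz norm of a radial function -/

namespace WeakTypeRadial

theorem tsum_comp_norm (k : ℕ) (φ : ℕ → ℝ≥0∞) :
    ∑' x : FreeGroup (Fin k), φ (FreeGroup.norm x) =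
      ∑' n, ((FreeGroup.reducedWords k n).card : ℝ≥0∞) * φ n := by
  classical
  have h1 : ∀ x : FreeGroup (Fin k), φ (FreeGroup.norm x) =
      ∑' n, if FreeGroup.norm x = n then φ n else 0 := fun x => by
    rw [tsum_eq_single (FreeGroup.norm x) fun n hn => if_neg hn.symm, if_pos rfl]
  simp only [h1]
  rw [ENNReal.tsum_comm]
  refine tsum_congr fun n => ?_
  have := tsum_ite_const {x : FreeGroup (Fin k) | FreeGroup.norm x = n} (φ n)
  simp only [Set.mem_ofPred_eq, FreeGroup.encard_sphere] at this
  rw [this, ENat.toENNReal_coe]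

theorem ofReal_pow_le_card {k : ℕ} (hk : 2 ≤ k) (n : ℕ) :
    ENNReal.ofReal ((2 * k - 1 : ℝ) ^ n) ≤ ((FreeGroup.reducedWords k n).card : ℝ≥0∞) := by
  rw [← ENNReal.ofReal_natCast]
  refine ENNReal.ofReal_le_ofReal ?_
  have := FreeGroup.le_card_reducedWords k n
  have h2 : (((2 * k - 1) ^ n : ℕ) : ℝ) ≤ (FreeGroup.reducedWords k n).card := by exact_mod_cast this
  rw [Nat.cast_pow, Nat.cast_sub (by omega)] at h2
  exact_mod_cast h2

theorem card_le_ofReal_pow {k : ℕ} (hk : 2 ≤ k) (n : ℕ) :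
    ((FreeGroup.reducedWords k n).card : ℝ≥0∞) ≤ ENNReal.ofReal (2 * (2 * k - 1 : ℝ) ^ n) := by
  rw [← ENNReal.ofReal_natCast]
  refine ENNReal.ofReal_le_ofReal ?_
  have := FreeGroup.card_reducedWords_le hk n
  have h2 : ((FreeGroup.reducedWords k n).card : ℝ) ≤ ((2 * (2 * k - 1) ^ n : ℕ) : ℝ) := by
    exact_mod_cast this
  rw [Nat.cast_mul, Nat.cast_pow, Nat.cast_sub (by omega)] at h2
  exact_mod_cast h2

open Classical in
theorem distribution_radial (k : ℕ) (a : ℕ → ℂ) (t : ℝ) :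
    distribution (radial k a) t =
      ∑' n, ((FreeGroup.reducedWords k n).card : ℝ≥0∞) * (if t < ‖a n‖ then 1 else 0) := by
  rw [← tsum_comp_norm]
  have := tsum_ite_const {x | t < ‖radial k a x‖} (1 : ℝ≥0∞)
  rw [mul_one] at this
  exact this.symm

theorem tsum_rpow_le_rpow_tsum {ρ : ℝ} (hρ : 1 ≤ ρ) (x : ℕ → ℝ≥0∞) :
    ∑' n, x n ^ ρ ≤ (∑' n, x n) ^ ρ := by
  refine ENNReal.tsum_le_of_sum_range_le fun N => ?_
  calc _ ≤ (∑ n ∈ Finset.range N, x n) ^ ρ := by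
        induction N with
        | zero => simp
        | succ N ih =>
          rw [Finset.sum_range_succ, Finset.sum_range_succ]
          exact (add_le_add_left ih _).trans (ENNReal.add_rpow_le_rpow_add _ _ hρ)
    _ ≤ _ := by
        gcongr
        exact ENNReal.sum_le_tsum _

open Classical in
/-- A partial sum of a geometric series is comparable to its largest term; hence taking powers
commutes with the sum, up to a constant. -/
theorem rpow_tsum_ite_pow_le {q : ℝ} (hq : 2 ≤ q) {ρ : ℝ} (hρ : 0 < ρ) (A : Set ℕ) :
    (∑' n, if n ∈ A then ENNReal.ofReal (q ^ n) else 0) ^ ρ ≤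
      ENNReal.ofReal (2 ^ ρ) * ∑' n, if n ∈ A then ENNReal.ofReal ((q ^ n) ^ ρ) else 0 := by
  have hq0 : 0 < q := by linarith
  rcases A.finite_or_infinite with hA | hA
  · rcases A.eq_empty_or_nonempty with rfl | hne
    · simp [hρ]
    obtain ⟨N, hN, hmax⟩ := hA.exists_maximalFor id A hne
    have hmax' : ∀ n ∈ A, n ≤ N := fun n hn => (le_total n N).elim id fun h => hmax hn h
    have geom : ∀ N, ∑ n ∈ Finset.range (N + 1), q ^ n ≤ 2 * q ^ N := fun N => by
      induction N with
      | zero => simp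
      | succ N ih =>
        rw [Finset.sum_range_succ, pow_succ q N]
        have : 0 < q ^ N := by positivity
        nlinarith
    calc _ ≤ ENNReal.ofReal (2 * q ^ N) ^ ρ := by
          gcongr
          rw [tsum_eq_sum (s := Finset.range (N + 1)) fun n hn => if_neg fun h => hn (by
            rw [Finset.mem_range]
            exact Nat.lt_succ_of_le (hmax' n h))]
          refine le_trans (Finset.sum_le_sum (g := fun n => ENNReal.ofReal (q ^ n))
            fun n _ => by split_ifs <;> simp) ?_
          rw [← ENNReal.ofReal_sum_of_nonneg fun n _ => by positivity]
          exact ENNReal.ofReal_le_ofReal (geom N)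
      _ = ENNReal.ofReal (2 ^ ρ) * (if N ∈ A then ENNReal.ofReal ((q ^ N) ^ ρ) else 0) := by
          rw [if_pos hN, ENNReal.ofReal_rpow_of_nonneg (by positivity) hρ.le,
            Real.mul_rpow (by norm_num) (by positivity), ENNReal.ofReal_mul (by positivity)]
      _ ≤ _ := by
          gcongr
          exact ENNReal.le_tsum (f := fun n => if n ∈ A then ENNReal.ofReal ((q ^ n) ^ ρ) else 0) N
  · have : ∑' n, (if n ∈ A then ENNReal.ofReal ((q ^ n) ^ ρ) else 0) = ∞ := by
      rw [eq_top_iff]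
      calc ∞ = ∑' n, (if n ∈ A then (1 : ℝ≥0∞) else 0) := by
            rw [tsum_ite_const, hA.encard_eq]
            simp
        _ ≤ _ := by
            refine ENNReal.tsum_le_tsum fun n => ?_
            split_ifs
            · rw [ENNReal.one_le_ofReal]
              exact Real.one_le_rpow (one_le_pow₀ (by linarith)) hρ.le
            · rfl
    rw [this, ENNReal.mul_top (by simp; positivity)]
    exact le_top

theorem lintegral_rpow_ite {s b : ℝ} (hs : 0 < s) (hb : 0 ≤ b) (c : ℝ≥0∞) :
    ∫⁻ t in Set.Ioi (0 : ℝ), ENNReal.ofReal (t ^ (s - 1)) * (if t < b then c else 0) =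
      ENNReal.ofReal (b ^ s / s) * c := by
  have h1 : ∀ t : ℝ, ENNReal.ofReal (t ^ (s - 1)) * (if t < b then c else 0) =
      (Set.Iio b).indicator (fun t => ENNReal.ofReal (t ^ (s - 1)) * c) t := fun t => by
    simp only [Set.indicator, Set.mem_Iio]
    split_ifs <;> simp
  have hmeas : Measurable fun t : ℝ => ENNReal.ofReal (t ^ (s - 1)) := by fun_prop
  simp only [h1]
  rw [MeasureTheory.setLIntegral_indicator measurableSet_Iio, Set.inter_comm, Set.Ioi_inter_Iio,
    MeasureTheory.setLIntegral_congr MeasureTheory.Ioo_ae_eq_Ioc,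
    MeasureTheory.lintegral_mul_const _ hmeas]
  congr 1
  have hint : IntervalIntegrable (fun t : ℝ => t ^ (s - 1)) MeasureTheory.volume 0 b :=
    intervalIntegral.intervalIntegrable_rpow' (by linarith)
  rw [← MeasureTheory.ofReal_integral_eq_lintegral_ofReal
    ((intervalIntegrable_iff_integrableOn_Ioc_of_le hb).1 hint)
    ((MeasureTheory.ae_restrict_iff' measurableSet_Ioc).2
      (Filter.Eventually.of_forall fun t ht => Real.rpow_nonneg ht.1.le _)),
    ← intervalIntegral.integral_of_le hb, integral_rpow (Or.inl (by linarith))]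
  rw [sub_add_cancel, Real.zero_rpow hs.ne', sub_zero]

open Classical in
theorem lintegral_tsum_ite_eq {p' : ℝ} (hp' : 0 < p') (a : ℕ → ℂ) (c : ℕ → ℝ≥0∞) :
    ∫⁻ t in Set.Ioi (0 : ℝ), ENNReal.ofReal (t ^ (p' - 1)) *
        ∑' n, (if t < ‖a n‖ then c n else 0) =
      ∑' n, ENNReal.ofReal (‖a n‖ ^ p' / p') * c n := by
  simp only [← ENNReal.tsum_mul_left]
  rw [MeasureTheory.lintegral_tsum fun n => ?_]
  · refine tsum_congr fun n => ?_
    rw [← lintegral_rpow_ite hp' (norm_nonneg _)]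
  · refine Measurable.aemeasurable (Measurable.mul (by fun_prop) ?_)
    exact Measurable.ite measurableSet_Iio measurable_const measurable_const

theorem exists_lorentzNorm_equiv {k : ℕ} (hk : 2 ≤ k) {p p' : ℝ} (hp : p.HolderConjugate p')
    (hp2 : p < 2) :
    ∃ K₁ K₂ : ℝ, 0 < K₁ ∧ 0 < K₂ ∧ ∀ a : ℕ → ℂ,
      lorentzNorm p p' (radial k a) ≤ ENNReal.ofReal K₁ * radialSum k p' a ^ (1 / p') ∧
      radialSum k p' a ^ (1 / p') ≤ ENNReal.ofReal K₂ * lorentzNorm p p' (radial k a) := by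
  classical
  have hp0 := hp.pos
  have hp'0 := hp.symm.pos
  have hρ : p' / p = p' - 1 := hp.symm.div_conj_eq_sub_one
  have hρ1 : 1 ≤ p' - 1 := by
    have h1 := hp.sub_one_mul_conj
    nlinarith [hp.sub_one_pos]
  have hq3 := three_le_two_mul_sub_one hk
  have hq0 : (0 : ℝ) < 2 * k - 1 := by linarith
  refine ⟨(p * (4 ^ (p' - 1) / p')) ^ (1 / p'), (p' / p) ^ (1 / p'), by positivity, by positivity,
    fun a => ?_⟩
  set J := ∫⁻ t in Set.Ioi (0 : ℝ), ENNReal.ofReal (t ^ (p' - 1)) *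
    ∑' n, (if t < ‖a n‖ then ENNReal.ofReal (((2 * k - 1 : ℝ) ^ n) ^ (p' - 1)) else 0) with hJ
  set I := ∫⁻ t in Set.Ioi (0 : ℝ), ENNReal.ofReal (t ^ (p' - 1)) *
    distribution (radial k a) t ^ (p' / p) with hI
  have hJV : radialSum k p' a = ENNReal.ofReal p' * J := by
    rw [hJ, lintegral_tsum_ite_eq hp'0, ← ENNReal.tsum_mul_left]
    refine tsum_congr fun n => ?_
    rw [← ENNReal.ofReal_mul (by positivity), ← ENNReal.ofReal_mul (by positivity)]
    congr 1
    field_simp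
  have hJI : J ≤ I := by
    refine MeasureTheory.lintegral_mono fun t => mul_le_mul_right ?_ _
    rw [distribution_radial, hρ]
    refine le_trans (ENNReal.tsum_le_tsum fun n => ?_) (tsum_rpow_le_rpow_tsum hρ1 _)
    split_ifs
    · rw [mul_one, ← ENNReal.ofReal_rpow_of_nonneg (by positivity) (by linarith)]
      exact ENNReal.rpow_le_rpow (ofReal_pow_le_card hk n) (by linarith)
    · exact zero_le
  have hIJ : I ≤ ENNReal.ofReal (4 ^ (p' - 1)) * J := by
    rw [hJ, ← MeasureTheory.lintegral_const_mul' _ _ ENNReal.ofReal_ne_top]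
    refine MeasureTheory.lintegral_mono fun t => ?_
    rw [mul_left_comm]
    refine mul_le_mul_right ?_ _
    rw [distribution_radial, hρ]
    have h1 : ∑' n, ((FreeGroup.reducedWords k n).card : ℝ≥0∞) * (if t < ‖a n‖ then 1 else 0) ≤
        ENNReal.ofReal 2 * ∑' n, if n ∈ {n | t < ‖a n‖} then
          ENNReal.ofReal ((2 * k - 1 : ℝ) ^ n) else 0 := by
      rw [← ENNReal.tsum_mul_left]
      refine ENNReal.tsum_le_tsum fun n => ?_
      simp only [Set.mem_ofPred_eq]
      split_ifs
      · rw [mul_one, ← ENNReal.ofReal_mul (by norm_num)]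
        exact card_le_ofReal_pow hk n
      · simp
    calc _ ≤ _ := ENNReal.rpow_le_rpow h1 (by linarith)
      _ = ENNReal.ofReal (2 ^ (p' - 1)) * _ := by
          rw [ENNReal.mul_rpow_of_nonneg _ _ (by linarith),
            ENNReal.ofReal_rpow_of_nonneg (by norm_num) (by linarith)]
      _ ≤ ENNReal.ofReal (2 ^ (p' - 1)) * (ENNReal.ofReal (2 ^ (p' - 1)) * _) :=
          mul_le_mul_right (rpow_tsum_ite_pow_le (by linarith) (by linarith) _) _
      _ = _ := by
          rw [← mul_assoc, ← ENNReal.ofReal_mul (by positivity),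
            ← Real.mul_rpow (by norm_num) (by norm_num)]
          norm_num
  have hL : lorentzNorm p p' (radial k a) = (ENNReal.ofReal p * I) ^ (1 / p') := rfl
  have h1p : (0 : ℝ) ≤ 1 / p' := by positivity
  rw [hL]
  constructor
  · rw [← ENNReal.ofReal_rpow_of_nonneg (by positivity) h1p, ← ENNReal.mul_rpow_of_nonneg _ _ h1p]
    refine ENNReal.rpow_le_rpow ?_ h1p
    rw [hJV, ← mul_assoc, ← ENNReal.ofReal_mul (by positivity)]
    refine (mul_le_mul_right hIJ _).trans_eq ?_
    rw [← mul_assoc, ← ENNReal.ofReal_mul (by positivity)]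
    congr 2
    field_simp
  · rw [← ENNReal.ofReal_rpow_of_nonneg (by positivity) h1p, ← ENNReal.mul_rpow_of_nonneg _ _ h1p]
    refine ENNReal.rpow_le_rpow ?_ h1p
    rw [hJV, ← mul_assoc, ← ENNReal.ofReal_mul (by positivity), div_mul_cancel₀ _ hp0.ne']
    exact mul_le_mul_right hJI _

end WeakTypeRadial

/-! ### Test functions for the lower bound -/

namespace WeakTypeRadial

/-- Going `n` steps from `x` towards the identity gives one term of size `a n` in the convolution;
these terms alone bound `f * h` from below. -/
theorem sum_le_re_conv {k : ℕ} {a : ℕ → ℝ} (ha : ∀ n, 0 ≤ a n) {G : ℕ → ℝ} (hG : ∀ m, 0 ≤ G m)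
    {h : FreeGroup (Fin k) → ℂ} (hh : ∀ z, G (FreeGroup.norm z) ≤ (h z).re)
    (hconv : ConvConverges (radial k fun n => (a n : ℂ)) h) (x : FreeGroup (Fin k)) :
    ∑ n ∈ Finset.range (FreeGroup.norm x + 1), a n * G (FreeGroup.norm x - n) ≤
      (conv (radial k fun n => (a n : ℂ)) h x).re := by
  have hre : HasSum (fun y => a (FreeGroup.norm y) * (h (y⁻¹ * x)).re)
      (conv (radial k fun n => (a n : ℂ)) h x).re := by
    have := Complex.hasSum_re (hconv x).hasSum
    simp only [radial, Complex.re_ofReal_mul] at this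
    exact this
  have hred := FreeGroup.isReduced_toWord (x := x)
  have hlen : x.toWord.length = FreeGroup.norm x := rfl
  set Y : ℕ → FreeGroup (Fin k) := fun n => FreeGroup.mk (x.toWord.take n) with hY
  have hYn : ∀ n ∈ Finset.range (FreeGroup.norm x + 1), FreeGroup.norm (Y n) = n := fun n hn => by
    rw [hY, FreeGroup.norm_mk_of_isReduced (hred.infix (List.take_prefix _ _).isInfix),
      List.length_take, hlen]
    rw [Finset.mem_range] at hn
    omega
  have hYx : ∀ n, FreeGroup.norm ((Y n)⁻¹ * x) = FreeGroup.norm x - n := fun n => by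
    have : (Y n)⁻¹ * x = FreeGroup.mk (x.toWord.drop n) := by
      rw [inv_mul_eq_iff_eq_mul, hY, FreeGroup.mul_mk, List.take_append_drop, FreeGroup.mk_toWord]
    rw [this, FreeGroup.norm_mk_of_isReduced (hred.infix (List.drop_suffix _ _).isInfix),
      List.length_drop, hlen]
  calc _ ≤ ∑ n ∈ Finset.range (FreeGroup.norm x + 1),
        a (FreeGroup.norm (Y n)) * (h ((Y n)⁻¹ * x)).re := by
        refine Finset.sum_le_sum fun n hn => ?_
        rw [hYn n hn, ← hYx n]
        exact mul_le_mul_of_nonneg_left (hh _) (ha n)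
    _ = ∑ y ∈ (Finset.range (FreeGroup.norm x + 1)).image Y,
        a (FreeGroup.norm y) * (h (y⁻¹ * x)).re := by
        rw [Finset.sum_image]
        intro m hm n hn hmn
        rw [← hYn m hm, ← hYn n hn, hmn]
    _ ≤ _ := sum_le_hasSum _ (fun y _ => mul_nonneg (ha _) ((hG _).trans (hh _))) hre

/-- A function of size at least `τ` on the sphere of radius `N` has weak norm at least
`τ * q ^ (N / p)`. -/
theorem le_weakNorm_of_sphere {k : ℕ} (hk : 2 ≤ k) {p : ℝ} (hp : 0 < p)
    {F : FreeGroup (Fin k) → ℂ} {N : ℕ} {τ : ℝ} (hF : ∀ x, FreeGroup.norm x = N → τ ≤ ‖F x‖) :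
    ENNReal.ofReal τ * ENNReal.ofReal (((2 * k - 1 : ℝ) ^ N) ^ (1 / p)) ≤ weakNorm p F := by
  have hq0 : (0 : ℝ) < 2 * k - 1 := by linarith [three_le_two_mul_sub_one hk]
  refine ENNReal.mul_le_of_forall_lt fun t ht c hc => ?_
  have htop : t ≠ ∞ := ht.ne_top
  rcases eq_or_ne t 0 with rfl | h0
  · simp
  have ht0 : 0 < t.toReal := ENNReal.toReal_pos h0 htop
  have htτ : t.toReal < τ := by
    rw [← ENNReal.ofReal_toReal htop] at ht
    exact (ENNReal.ofReal_lt_ofReal_iff_of_nonneg ht0.le).1 ht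
  calc t * c ≤ ENNReal.ofReal t.toReal * distribution F t.toReal ^ (1 / p) := by
        rw [ENNReal.ofReal_toReal htop]
        refine mul_le_mul_right (hc.le.trans ?_) _
        rw [← ENNReal.ofReal_rpow_of_nonneg (by positivity) (by positivity)]
        refine ENNReal.rpow_le_rpow ((ofReal_pow_le_card hk N).trans ?_) (by positivity)
        rw [← ENat.toENNReal_coe, ← FreeGroup.encard_sphere]
        unfold distribution
        refine ENat.toENNReal_le.2 (Set.encard_le_encard fun x hx => htτ.trans_le (hF x hx))
    _ ≤ _ := le_iSup₂ (f := fun (t : ℝ) (_ : 0 < t) =>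
        ENNReal.ofReal t * distribution F t ^ (1 / p)) t.toReal ht0

/-- For the truncation of `V` at `N`, a test function `g` in the unit ball of `ℓ^p`. The bound is
stated for every `h` which dominates a multiple of `g`, so that it applies to sums of test
functions too. -/
theorem exists_test_function {k : ℕ} (hk : 2 ≤ k) {p p' : ℝ} (hp : p.HolderConjugate p')
    {a : ℕ → ℝ} (ha : ∀ n, 0 ≤ a n) (N : ℕ) {S : ℝ} (hS : 0 < S)
    (hSa : S = ∑ n ∈ Finset.range (N + 1), a n ^ p' * ((2 * k - 1 : ℝ) ^ n) ^ (p' - 1)) :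
    ∃ g : lp (fun _ : FreeGroup (Fin k) => ℂ) (ENNReal.ofReal p), ‖g‖ ≤ 1 ∧
      (∀ z, 0 ≤ (g z).re) ∧
      ∀ (h : FreeGroup (Fin k) → ℂ) (c : ℝ), 0 ≤ c → (∀ z, c * (g z).re ≤ (h z).re) →
        ConvConverges (radial k fun n => (a n : ℂ)) h →
        ENNReal.ofReal (c * (2 ^ (-(1 / p)) * S ^ (1 / p'))) ≤
          weakNorm p (conv (radial k fun n => (a n : ℂ)) h) := by
  have hp0 := hp.pos
  have hp'0 := hp.symm.pos
  have hq0 : (0 : ℝ) < 2 * k - 1 := by linarith [three_le_two_mul_sub_one hk]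
  set q : ℝ := 2 * k - 1 with hq
  have hqn : ∀ n, 0 < q ^ n := fun n => by positivity
  have hpt : (ENNReal.ofReal p).toReal = p := ENNReal.toReal_ofReal hp0.le
  -- `G` is the extremal sequence for Hölder's inequality against `n ↦ a n * q ^ (n / p)`,
  -- reversed.
  set G : ℕ → ℝ := fun m => if m ≤ N then
    (2 * S) ^ (-(1 / p)) * (q ^ m) ^ (-(1 / p)) *
      (a (N - m) * (q ^ (N - m)) ^ (1 / p)) ^ (p' - 1) else 0 with hG
  have hbase : ∀ n, 0 ≤ a n * (q ^ n) ^ (1 / p) := fun n =>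
    mul_nonneg (ha n) (Real.rpow_nonneg (hqn n).le _)
  have hG0 : ∀ m, 0 ≤ G m := fun m => by
    simp only [hG]
    split_ifs
    · have := Real.rpow_nonneg (hbase (N - m)) (p' - 1)
      positivity
    · exact le_rfl
  have hpow : ∀ n, (a n * (q ^ n) ^ (1 / p)) ^ p' = a n ^ p' * (q ^ n) ^ (p' - 1) := fun n => by
    rw [Real.mul_rpow (ha n) (Real.rpow_nonneg (hqn n).le _), ← Real.rpow_mul (hqn n).le,
      ← hp.symm.div_conj_eq_sub_one]
    congr 2
    ring
  have hGp : ∑' z : FreeGroup (Fin k), ENNReal.ofReal (G (FreeGroup.norm z) ^ p) ≤ 1 := by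
    rw [tsum_comp_norm k fun n => ENNReal.ofReal (G n ^ p),
      tsum_eq_sum (s := Finset.range (N + 1)) fun n hn => ?_]
    · calc _ ≤ ∑ m ∈ Finset.range (N + 1), ENNReal.ofReal
            (S⁻¹ * (a (N - m) ^ p' * (q ^ (N - m)) ^ (p' - 1))) := by
            refine Finset.sum_le_sum fun m hm => ?_
            have hmN : m ≤ N := Nat.lt_succ_iff.1 (Finset.mem_range.1 hm)
            refine (mul_le_mul_left (card_le_ofReal_pow hk m) _).trans_eq ?_
            rw [← hq, ← ENNReal.ofReal_mul (by positivity)]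
            congr 1
            have e : ∀ y : ℝ, 0 < y → (y ^ (-(1 / p))) ^ p = y⁻¹ := fun y hy => by
              rw [← Real.rpow_mul hy.le, neg_mul, one_div_mul_cancel hp0.ne', Real.rpow_neg_one]
            have e2 : (p' - 1) * p = p' := by
              rw [mul_comm, mul_sub, mul_one, hp.mul_eq_add]; ring
            have h3 := Real.rpow_nonneg (hbase (N - m)) (p' - 1)
            simp only [hG, if_pos hmN]
            rw [Real.mul_rpow (by positivity) h3,
              Real.mul_rpow (by positivity) (Real.rpow_nonneg (hqn m).le _), e _ (by positivity),
              e _ (hqn m), ← Real.rpow_mul (hbase _), e2, hpow]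
            have := hqn m
            field_simp
        _ = ENNReal.ofReal (∑ m ∈ Finset.range (N + 1),
            S⁻¹ * (a (N - m) ^ p' * (q ^ (N - m)) ^ (p' - 1))) :=
            (ENNReal.ofReal_sum_of_nonneg fun m _ => by
              have := Real.rpow_nonneg (ha (N - m)) p'
              positivity).symm
        _ = 1 := by
            rw [← Finset.mul_sum, ENNReal.ofReal_eq_one]
            have := Finset.sum_range_reflect (fun n => a n ^ p' * (q ^ n) ^ (p' - 1)) (N + 1)
            simp only [Nat.add_sub_cancel] at this
            rw [this, ← hSa, inv_mul_cancel₀ hS.ne']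
    · rw [Finset.mem_range, not_lt] at hn
      simp only [hG]
      rw [if_neg (by omega), Real.zero_rpow hp0.ne']
      simp
  have hsummable : Summable fun z : FreeGroup (Fin k) => G (FreeGroup.norm z) ^ p := by
    have := ENNReal.summable_toReal (ne_top_of_le_ne_top ENNReal.one_ne_top hGp)
    refine this.congr fun z => ?_
    rw [ENNReal.toReal_ofReal (Real.rpow_nonneg (hG0 _) _)]
  have hnorm : ∀ z : FreeGroup (Fin k), ‖((G (FreeGroup.norm z) : ℝ) : ℂ)‖ =
      G (FreeGroup.norm z) := fun z => by
    rw [Complex.norm_real, Real.norm_of_nonneg (hG0 _)]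
  have hmem : Memℓp (fun z : FreeGroup (Fin k) => ((G (FreeGroup.norm z) : ℝ) : ℂ))
      (ENNReal.ofReal p) := by
    rw [memℓp_gen_iff (by rw [hpt]; exact hp0), hpt]
    simpa only [hnorm] using hsummable
  refine ⟨⟨_, hmem⟩, ?_, fun z => hG0 _, fun h c hc hh hconv => ?_⟩
  · refine lp.norm_le_of_tsum_le (by rw [hpt]; exact hp0) zero_le_one ?_
    rw [hpt, Real.one_rpow]
    simp only [hnorm]
    rw [← ENNReal.ofReal_le_one, ENNReal.ofReal_tsum_of_nonneg
      (fun z => Real.rpow_nonneg (hG0 _) _) hsummable]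
    exact hGp
  · refine le_trans (le_of_eq ?_) (le_weakNorm_of_sphere hk hp0 (N := N)
      (τ := c * ((2 * S) ^ (-(1 / p)) * (q ^ N) ^ (-(1 / p)) * S)) fun x hx => ?_)
    · rw [← hq, ← ENNReal.ofReal_mul (by positivity)]
      congr 1
      have e1 : S ^ (1 / p') = S ^ (-(1 / p)) * S := by
        rw [← Real.rpow_add_one hS.ne']
        congr 1
        have := hp.inv_add_inv_eq_one
        rw [one_div, one_div]
        linarith
      rw [e1, Real.mul_rpow (by norm_num) hS.le, Real.rpow_neg (hqn N).le]
      have := Real.rpow_pos_of_pos (hqn N) (1 / p)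
      field_simp
    · refine le_trans (le_of_eq ?_) ((sum_le_re_conv ha (G := fun m => c * G m)
        (fun m => mul_nonneg hc (hG0 m)) hh hconv x).trans (Complex.re_le_norm _))
      have e3 : c * ((2 * S) ^ (-(1 / p)) * (q ^ N) ^ (-(1 / p)) * S) =
          c * (2 * S) ^ (-(1 / p)) * (q ^ N) ^ (-(1 / p)) *
            ∑ n ∈ Finset.range (N + 1), a n ^ p' * (q ^ n) ^ (p' - 1) := by
        rw [← hSa]
        ring
      rw [hx, e3, Finset.mul_sum]
      refine Finset.sum_congr rfl fun n hn => ?_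
      have hnN : n ≤ N := Nat.lt_succ_iff.1 (Finset.mem_range.1 hn)
      simp only [hG, if_pos (Nat.sub_le N n), Nat.sub_sub_self hnN]
      have hsplit : (q ^ (N - n)) ^ (-(1 / p)) = (q ^ N) ^ (-(1 / p)) * (q ^ n) ^ (1 / p) := by
        have : q ^ N = q ^ (N - n) * q ^ n := by rw [← pow_add, Nat.sub_add_cancel hnN]
        rw [this, Real.mul_rpow (hqn _).le (hqn _).le, Real.rpow_neg (hqn n).le]
        have := Real.rpow_pos_of_pos (hqn n) (1 / p)
        field_simp
      rw [hsplit, ← hpow]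
      have hF : (a n * (q ^ n) ^ (1 / p)) ^ p' =
          a n * (q ^ n) ^ (1 / p) * (a n * (q ^ n) ^ (1 / p)) ^ (p' - 1) := by
        rcases (hbase n).eq_or_lt with h0 | h0
        · rw [← h0, Real.zero_rpow hp'0.ne', zero_mul]
        · rw [Real.rpow_sub_one h0.ne', mul_div_cancel₀ _ h0.ne']
      rw [hF]
      ring

end WeakTypeRadial

/-! ### Comparison of the norms -/

namespace WeakTypeRadial

theorem radialSum_ofReal_eq {k : ℕ} {p' : ℝ} {a : ℕ → ℝ} (ha : ∀ n, 0 ≤ a n) :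
    radialSum k p' (fun n => (a n : ℂ)) =
      ∑' n, ENNReal.ofReal (a n ^ p' * ((2 * k - 1 : ℝ) ^ n) ^ (p' - 1)) := by
  simp only [radialSum, Complex.norm_real, Real.norm_of_nonneg (ha _)]

theorem radialSum_le_opNorm {k : ℕ} (hk : 2 ≤ k) {p p' : ℝ} (hp : p.HolderConjugate p')
    {a : ℕ → ℝ} (ha : ∀ n, 0 ≤ a n) :
    radialSum k p' (fun n => (a n : ℂ)) ^ (1 / p') ≤
      ENNReal.ofReal (2 ^ (1 / p)) * opNorm p (radial k fun n => (a n : ℂ)) := by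
  have hp'0 := hp.symm.pos
  have hq0 : (0 : ℝ) < 2 * k - 1 := by linarith [three_le_two_mul_sub_one hk]
  have h2 : (0 : ℝ) < 2 ^ (1 / p) := by positivity
  rw [← ENNReal.div_le_iff' (by simpa using h2) ENNReal.ofReal_ne_top]
  refine le_sInf fun A hA => ?_
  rw [ENNReal.div_le_iff' (by simpa using h2) ENNReal.ofReal_ne_top, one_div,
    ENNReal.rpow_inv_le_iff hp'0, radialSum_ofReal_eq ha]
  have hterm : ∀ n, 0 ≤ a n ^ p' * ((2 * k - 1 : ℝ) ^ n) ^ (p' - 1) := fun n =>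
    mul_nonneg (Real.rpow_nonneg (ha n) _) (by positivity)
  refine ENNReal.tsum_le_of_sum_range_le fun N => ?_
  rw [← ENNReal.rpow_inv_le_iff hp'0, ← one_div]
  refine le_trans (ENNReal.rpow_le_rpow (Finset.sum_le_sum_of_subset
    (Finset.range_mono (Nat.le_succ N))) (by positivity)) ?_
  rw [← ENNReal.ofReal_sum_of_nonneg fun n _ => hterm n]
  set S := ∑ n ∈ Finset.range (N + 1), a n ^ p' * ((2 * k - 1 : ℝ) ^ n) ^ (p' - 1) with hS
  have hS0 : 0 ≤ S := Finset.sum_nonneg fun n _ => hterm n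
  rcases hS0.eq_or_lt with h0 | hpos
  · rw [← h0, ENNReal.ofReal_zero, ENNReal.zero_rpow_of_pos (by positivity)]
    exact zero_le
  obtain ⟨g, hg1, hg0, hg⟩ := exists_test_function hk hp ha N hpos hS
  have h3 := (hg g 1 zero_le_one (fun z => (one_mul _).le) (hA g).1).trans (hA g).2
  have h4 : A * ENNReal.ofReal ‖g‖ ≤ A :=
    mul_le_of_le_one_right' (ENNReal.ofReal_le_one.2 hg1)
  calc ENNReal.ofReal S ^ (1 / p') = ENNReal.ofReal (2 ^ (1 / p)) *
        ENNReal.ofReal (1 * (2 ^ (-(1 / p)) * S ^ (1 / p'))) := by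
        rw [← ENNReal.ofReal_mul h2.le, ENNReal.ofReal_rpow_of_nonneg hpos.le (by positivity),
          Real.rpow_neg (by norm_num)]
        congr 1
        field_simp
    _ ≤ _ := mul_le_mul_right (h3.trans h4) _

/-- If the power sum diverges, a sum `∑ 2 ^ (-j) g_j` of normalized test functions on which
`λ(f)` is larger than `4 ^ j` is mapped out of weak `L^p`: by positivity the contributions of
different `j` do not cancel. -/
theorem radialSum_ne_top_of_isWeakType {k : ℕ} (hk : 2 ≤ k) {p p' : ℝ}
    (hp : p.HolderConjugate p') {a : ℕ → ℝ} (ha : ∀ n, 0 ≤ a n)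
    (hw : IsWeakType p (radial k fun n => (a n : ℂ))) :
    radialSum k p' (fun n => (a n : ℂ)) ≠ ∞ := by
  intro htop
  have hp'0 := hp.symm.pos
  have hq0 : (0 : ℝ) < 2 * k - 1 := by linarith [three_le_two_mul_sub_one hk]
  have hterm : ∀ n, 0 ≤ a n ^ p' * ((2 * k - 1 : ℝ) ^ n) ^ (p' - 1) := fun n =>
    mul_nonneg (Real.rpow_nonneg (ha n) _) (by positivity)
  rw [radialSum_ofReal_eq ha, ENNReal.tsum_eq_iSup_nat] at htop
  have hlarge : ∀ M : ℝ, ∃ N, M < ∑ n ∈ Finset.range (N + 1),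
      a n ^ p' * ((2 * k - 1 : ℝ) ^ n) ^ (p' - 1) := fun M => by
    obtain ⟨N, hN⟩ := lt_iSup_iff.1 (htop ▸ ENNReal.ofReal_lt_top (r := M))
    rw [← ENNReal.ofReal_sum_of_nonneg fun n _ => hterm n] at hN
    refine ⟨N, (ENNReal.ofReal_lt_ofReal_iff'.1 hN).1.trans_le ?_⟩
    rw [Finset.sum_range_succ]
    linarith [hterm N]
  have : Fact (1 ≤ ENNReal.ofReal p) := ⟨by simpa using hp.lt.le⟩
  have htest : ∀ j : ℕ, ∃ g : lp (fun _ : FreeGroup (Fin k) => ℂ) (ENNReal.ofReal p), ‖g‖ ≤ 1 ∧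
      (∀ z, 0 ≤ (g z).re) ∧
      ∀ (h : FreeGroup (Fin k) → ℂ) (c : ℝ), 0 ≤ c → (∀ z, c * (g z).re ≤ (h z).re) →
        ConvConverges (radial k fun n => (a n : ℂ)) h →
        ENNReal.ofReal (c * 4 ^ j) ≤ weakNorm p (conv (radial k fun n => (a n : ℂ)) h) := by
    intro j
    obtain ⟨N, hN⟩ := hlarge ((2 ^ (1 / p) * 4 ^ j) ^ p')
    have hS : 0 < ∑ n ∈ Finset.range (N + 1), a n ^ p' * ((2 * k - 1 : ℝ) ^ n) ^ (p' - 1) :=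
      lt_of_le_of_lt (by positivity) hN
    obtain ⟨g, hg1, hg0, hg⟩ := exists_test_function hk hp ha N hS rfl
    refine ⟨g, hg1, hg0, fun h c hc hh hconv => le_trans ?_ (hg h c hc hh hconv)⟩
    refine ENNReal.ofReal_le_ofReal (mul_le_mul_of_nonneg_left ?_ hc)
    have h5 : (2 ^ (1 / p) * 4 ^ j : ℝ) ≤ (∑ n ∈ Finset.range (N + 1),
        a n ^ p' * ((2 * k - 1 : ℝ) ^ n) ^ (p' - 1)) ^ (1 / p') := by
      rw [one_div p', Real.le_rpow_inv_iff_of_pos (by positivity) hS.le hp'0]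
      exact hN.le
    rw [Real.rpow_neg (by norm_num), ← div_eq_inv_mul, le_div_iff₀ (by positivity), mul_comm]
    exact h5
  choose g hg1 hg0 hg using htest
  have hsum : Summable fun j : ℕ => ((1 / 2 : ℝ) ^ j) • g j := by
    refine Summable.of_norm_bounded summable_geometric_two fun j => ?_
    rw [norm_smul, Real.norm_of_nonneg (by positivity)]
    exact mul_le_of_le_one_right (by positivity) (hg1 j)
  set G := ∑' j : ℕ, ((1 / 2 : ℝ) ^ j) • g j with hG
  have hcoord : ∀ z, HasSum (fun j : ℕ => (1 / 2 : ℝ) ^ j * (g j z).re) (G z).re := fun z => by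
    have h6 := (Complex.reCLM.comp (lp.evalCLM ℝ (fun _ : FreeGroup (Fin k) => ℂ)
      (ENNReal.ofReal p) z)).hasSum hsum.hasSum
    simp only [map_smul, smul_eq_mul] at h6
    exact h6
  have hbig : ∀ j : ℕ, ENNReal.ofReal (2 ^ j) ≤
      weakNorm p (conv (radial k fun n => (a n : ℂ)) G) := fun j => by
    have := hg j G ((1 / 2) ^ j) (by positivity)
      (fun z => le_hasSum (hcoord z) j fun i _ => mul_nonneg (by positivity) (hg0 i z)) (hw G).1
    rwa [← mul_pow, show (1 / 2 * 4 : ℝ) = 2 by norm_num] at this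
  have hlt := (hw G).2
  obtain ⟨j, hj⟩ := pow_unbounded_of_one_lt
    (weakNorm p (conv (radial k fun n => (a n : ℂ)) G)).toReal one_lt_two
  exact absurd ((ENNReal.ofReal_le_iff_le_toReal hlt.ne).1 (hbig j)) hj.not_ge

theorem isWeakType_of_opNorm_lt_top {G : Type*} [Group G] {p : ℝ} {f : G → ℂ}
    (h : opNorm p f < ∞) : IsWeakType p f := by
  obtain ⟨A, hA, hAtop⟩ := sInf_lt_iff.1 h
  exact fun g => ⟨(hA g).1, (hA g).2.trans_lt (ENNReal.mul_lt_top hAtop ENNReal.ofReal_lt_top)⟩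

end WeakTypeRadial

theorem theorem4 (k : ℕ) (hk : 2 ≤ k) (p : ℝ) (hp1 : 1 < p) (hp2 : p < 2) :
    (∃ C : ℝ, 0 < C ∧ ∀ a : ℕ → ℂ,
      WeakTypeRadial.opNorm p (WeakTypeRadial.radial k a) ≤
        ENNReal.ofReal C *
          WeakTypeRadial.lorentzNorm p (p / (p - 1)) (WeakTypeRadial.radial k a)) ∧
    (∃ c : ℝ, 0 < c ∧ ∀ a : ℕ → ℝ, (∀ n, 0 ≤ a n) →
      ENNReal.ofReal c *
          WeakTypeRadial.lorentzNorm p (p / (p - 1))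
            (WeakTypeRadial.radial k fun n => (a n : ℂ)) ≤
        WeakTypeRadial.opNorm p (WeakTypeRadial.radial k fun n => (a n : ℂ))) ∧
    (∀ a : ℕ → ℝ, (∀ n, 0 ≤ a n) →
      (WeakTypeRadial.IsWeakType p (WeakTypeRadial.radial k fun n => (a n : ℂ)) ↔
        WeakTypeRadial.lorentzNorm p (p / (p - 1))
          (WeakTypeRadial.radial k fun n => (a n : ℂ)) < ∞)) := by
  have hp : p.HolderConjugate (p / (p - 1)) := Real.HolderConjugate.conjExponent hp1
  obtain ⟨K, hK, hop⟩ := WeakTypeRadial.exists_opNorm_le hk hp hp2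
  obtain ⟨K₁, K₂, hK₁, hK₂, hL⟩ := WeakTypeRadial.exists_lorentzNorm_equiv hk hp hp2
  have upper : ∀ a : ℕ → ℂ, WeakTypeRadial.opNorm p (WeakTypeRadial.radial k a) ≤
      ENNReal.ofReal (K * K₂) *
        WeakTypeRadial.lorentzNorm p (p / (p - 1)) (WeakTypeRadial.radial k a) := fun a => by
    rw [ENNReal.ofReal_mul hK.le, mul_assoc]
    exact (hop a).trans (mul_le_mul_right (hL a).2 _)
  refine ⟨⟨K * K₂, by positivity, upper⟩, ⟨(K₁ * 2 ^ (1 / p))⁻¹, by positivity, fun a ha => ?_⟩,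
    fun a ha => ⟨fun hw => ?_, fun hfin => ?_⟩⟩
  · have h0 : 0 < K₁ * 2 ^ (1 / p) := by positivity
    rw [ENNReal.ofReal_inv_of_pos h0, ENNReal.inv_mul_le_iff (by simpa using h0)
      ENNReal.ofReal_ne_top, ENNReal.ofReal_mul hK₁.le, mul_assoc]
    exact (hL _).1.trans (mul_le_mul_right (WeakTypeRadial.radialSum_le_opNorm hk hp ha) _)
  · exact (hL _).1.trans_lt (ENNReal.mul_lt_top ENNReal.ofReal_lt_top
      (ENNReal.rpow_lt_top_of_nonneg (by have := hp.symm.pos; positivity)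
        (WeakTypeRadial.radialSum_ne_top_of_isWeakType hk hp ha hw)))
  · exact WeakTypeRadial.isWeakType_of_opNorm_lt_top
      ((upper _).trans_lt (ENNReal.mul_lt_top ENNReal.ofReal_lt_top hfin))
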